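/- Let $\Pi_\ell,\Pi_e\subset\mathbb{R}^2$ be independent homogeneous Poisson point processes with densities $\lambda_\ell>0$ (legitimate nodes) and $\lambda_e>0$ (eavesdroppers). The power received at $y$ from a transmitter at $x$ is $P\,g(|x-y|)$, where $P>0$ and $g$ is continuous and strictly decreasing on $(0,\infty)$ with $\lim_{r\to\infty}g(r)=0$ (path loss only), and all noise powers equal $\sigma^2>0$. The Poisson $i\mathcal{S}$-graph with zero secrecy-rate threshold is the directed graph with vertex set $\Pi_\ell$ in which there is an edge from $x$ to $y\neq x$ if and only if $$\Bigl[\log_2\Bigl(1+\tfrac{P g(|x-y|)}{\sigma^2}\Bigr)-\log_2\Bigl(1+\tfrac{P g(|x-e^*|)}{\sigma^2}\Bigr)\Bigr]^+>0,\qquad e^*=\operatorname*{argmax}_{e\in\Pi_e}P g(|x-e|).$$ Let $N_{\mathrm{in}}$ be the in-degree (number of entering edges) of a typical node, that is, the in-degree under the Palm distribution of $\Pi_\ell$: for a nonnegative function $F$ and any Borel window $W$ of area $0<|W|<\infty$, $$\mathbb{E}\{F(N_{\mathrm{in}})\}=\frac{1}{\lambda_\ell|W|}\,\mathbb{E}\Bigl\{\sum_{x\in\Pi_\ell\cap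 W}F(\text{in-degree of }x)\Bigr\}.$$ Let $\widetilde{A}$ be the area of a typical Voronoi cell induced by a unit-density Poisson process $\widetilde\Pi$ in $\mathbb{R}^2$, that is, the area of $\{y\in\mathbb{R}^2:|y|<|y-z|\ \text{for all } z\in\widetilde\Pi,\ z\neq 0\}$, the cell of the origin in the tessellation induced by $\widetilde\Pi\cup\{0\}$. **Theorem.** For every $s\in\mathbb{R}$, as an identity in $[0,\infty]$, the moment generating function of $N_{\mathrm{in}}$ is $$\mathbb{E}\{e^{sN_{\mathrm{in}}}\}=\mathbb{E}\Bigl\{\exp\Bigl(\frac{\lambda_\ell}{\lambda_e}\,\widetilde{A}\,(e^{s}-1)\Bigr)\Bigr\}.$$ Furthermore, all moments of $\widetilde A$ are finite, and for every integer $n\ge1$ $$\mathbb{E}\{N_{\mathrm{in}}^{n}\}=\sum_{k=1}^{n}\Bigl(\frac{\lambda_\ell}{\lambda_e}\Bigr)^{k}S(n,k)\,\mathbb{E}\{\widetilde{A}^{k}\},$$ where $S(n,k)$ are the Stirling numbers of the second kind. In particular these moments of $N_{\mathrm{in}}$ are finite. -/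

import Mathlib

open MeasureTheory Filter Topology
open scoped NNReal ENNReal

/-- The Euclidean plane `ℝ²`. -/
abbrev Plane : Type := EuclideanSpace ℝ (Fin 2)

/-! ### Point processes -/

/-- The number of points that the random set `X` has in `B`. -/
noncomputable def pointCount {Ω : Type*} (X : Ω → Set Plane) (B : Set Plane) (ω : Ω) : ℕ∞ :=
  (X ω ∩ B).encard

/-- The σ-algebra generated by a point process, that is, by its counts on Borel sets. -/
@[reducible]
noncomputable def pointSigma {Ω : Type*} (X : Ω → Set Plane) : MeasurableSpace Ω :=
  ⨆ (B : Set Plane) (_ : MeasurableSet B),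
    MeasurableSpace.comap (pointCount X B) inferInstance

/-- `X` is a homogeneous Poisson point process in the plane with density `lam`: a locally finite
random set whose counts are random variables, Poisson distributed with mean `lam` times the area,
and independent on pairwise disjoint Borel sets. -/
structure IsPoissonProcess {Ω : Type*} [MeasurableSpace Ω] (μ : Measure Ω)
    (X : Ω → Set Plane) (lam : ℝ≥0) : Prop where
  locallyFinite : ∀ ω, ∀ B : Set Plane, Bornology.IsBounded B → (X ω ∩ B).Finite
  measurable_count : ∀ B : Set Plane, MeasurableSet B → Measurable (pointCount X B)
  count_law : ∀ B : Set Plane, MeasurableSet B → volume B ≠ ∞ → ∀ k : ℕ,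
    μ {ω | pointCount X B ω = k} = ProbabilityTheory.poissonMeasure (lam * (volume B).toNNReal) {k}
  count_indep : ∀ (n : ℕ) (B : Fin n → Set Plane), (∀ i, MeasurableSet (B i)) →
    Pairwise (fun i j => Disjoint (B i) (B j)) →
    ProbabilityTheory.iIndepFun (fun i => pointCount X (B i)) μ

/-- The Palm mean, with respect to a stationary point process `X` of density `lam`, of a
`[0, ∞]`-valued mark `f ω x` attached to the points `x ∈ X ω`: the expected sum of the marks of the
points in the window `W`, divided by the expected number of points in `W`. This is the expectation
of the mark of a typical point of `X`. -/
noncomputable def palmMean {Ω : Type*} [MeasurableSpace Ω] (μ : Measure Ω)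
    (X : Ω → Set Plane) (lam : ℝ≥0) (W : Set Plane) (f : (ω : Ω) → X ω → ℝ≥0∞) : ℝ≥0∞ :=
  (∫⁻ ω, ∑' x : X ω, W.indicator (fun _ => f ω x) (x : Plane) ∂μ) / (lam * volume W)

/-! ### The intrinsically secure graph -/

/-- The power received at `y` from a transmitter at `x` with transmit power `P`, when the gain of a
link of length `r` with propagation effect `z` is `g r z`. -/
noncomputable def rxPower (P : ℝ) (g : ℝ → ℝ → ℝ) (Z : Plane → Plane → ℝ) (x y : Plane) : ℝ :=
  P * g (dist x y) (Z x y)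

/-- The maximum secrecy rate of the link from `x` to `y`, when `e` is the eavesdropper with the
strongest received signal from `x`; `noiseL`, `noiseE` are the noise powers of the legitimate nodes
and of the eavesdroppers. -/
noncomputable def secrecyRate (P : ℝ) (g : ℝ → ℝ → ℝ) (Z : Plane → Plane → ℝ)
    (noiseL noiseE : ℝ) (x y e : Plane) : ℝ :=
  max (Real.logb 2 (1 + rxPower P g Z x y / noiseL)
    - Real.logb 2 (1 + rxPower P g Z x e / noiseE)) 0

/-- The `iS`-graph on the legitimate nodes `L` with eavesdroppers `E` and secrecy rate threshold
`rho`: there is an edge from `x` to `y ≠ x` when the maximum secrecy rate of this link, computed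
with the eavesdropper `e ∈ E` that maximizes the power received from `x`, exceeds `rho`. -/
def iSGraph (P : ℝ) (g : ℝ → ℝ → ℝ) (Z : Plane → Plane → ℝ) (noiseL noiseE rho : ℝ)
    (L E : Set Plane) : Digraph L where
  Adj x y := x ≠ y ∧ ∃ e ∈ E, IsMaxOn (rxPower P g Z x) E e ∧
    rho < secrecyRate P g Z noiseL noiseE x y e

/-- The in-degree of a vertex: the number of edges entering it. -/
noncomputable def inDegree {V : Type*} (G : Digraph V) (v : V) : ℕ∞ :=
  {u : V | G.Adj u v}.encard

/-! ### Voronoi cells -/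

/-- The Voronoi cell of `x` with respect to the point set `S`. -/
def voronoiCell (S : Set Plane) (x : Plane) : Set Plane :=
  {y | ∀ z ∈ S, z ≠ x → dist y x < dist y z}

/-- The area of the cell of the origin in the Voronoi tessellation induced by the points of `S`
together with the origin. -/
noncomputable def originCellArea (S : Set Plane) : ℝ≥0∞ :=
  volume (voronoiCell (insert 0 S) 0)

/-! With equal noise powers and strictly decreasing gain, an edge `u → x` exists iff `u` is closer
to `x` than to every eavesdropper, that is, iff `u ≠ x` lies in the Voronoi cell of `x` relative to
`E` (`iSGraph_adj_iff`). The in-degree of `x` is thus the number of other legitimate nodes in that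
cell.

The Mecke formula (`lintegral_lintegral_pointKernel`) turns the Palm mean into an average over fixed
points `x` added to `L`; the added point does not count itself. Given `E`, the count is Poisson with
mean `lamL` times the cell area. By scaling and uniqueness of the Poisson law
(`map_volume_voronoiCell`), this area is distributed as the unit-density area divided by `lamE`.
Hence the in-degree is mixed Poisson (`palmMean_inDegree`), and both formulas follow by averaging
the Poisson generating function and moments.

Mecke's formula comes from the Chen–Stein identity for the independent counts on a finite partition,
extended by a π-system argument. The area moments are finite because a point at distance `r` from
the origin lies in the origin's cell with probability Gaussian in `r`. -/

/-- The locally finite subsets of the plane. -/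
structure Config where
  /-- The points of the configuration. -/
  carrier : Set Plane
  locallyFinite : ∀ B : Set Plane, Bornology.IsBounded B → (carrier ∩ B).Finite

noncomputable instance Config.instMeasurableSpace : MeasurableSpace Config :=
  pointSigma Config.carrier

/-! ### Configurations and their counting kernel -/

namespace Config

theorem measurable_pointCount {B : Set Plane} (hB : MeasurableSet B) :
    Measurable (pointCount Config.carrier B) :=
  Measurable.of_comap_le (le_iSup₂_of_le B hB le_rfl)

theorem countable (φ : Config) : (φ.carrier : Set Plane).Countable := by
  have h : φ.carrier = ⋃ n : ℕ, φ.carrier ∩ Metric.ball 0 n := by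
    rw [← Set.inter_iUnion, Metric.iUnion_ball_nat, Set.inter_univ]
  rw [h]
  exact Set.countable_iUnion fun n => (φ.locallyFinite _ Metric.isBounded_ball).countable

/-- The counting measure of a configuration, as a kernel. -/
noncomputable def pointKernel : ProbabilityTheory.Kernel Config Plane where
  toFun φ := Measure.count.restrict φ.carrier
  measurable' := by
    refine Measure.measurable_of_measurable_coe _ fun B hB => ?_
    have h : (fun φ : Config => (Measure.count.restrict φ.carrier) B)
        = fun φ => (pointCount Config.carrier B φ : ℝ≥0∞) := by
      funext φ
      rw [Measure.restrict_apply hB, Measure.count_apply (hB.inter φ.countable.measurableSet),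
        Set.inter_comm]
      rfl
    rw [h]
    exact (Measurable.of_discrete (f := fun n : ℕ∞ => (n : ℝ≥0∞))).comp (measurable_pointCount hB)

theorem pointKernel_apply (φ : Config) {B : Set Plane} (hB : MeasurableSet B) :
    pointKernel φ B = ((φ.carrier ∩ B).encard : ℝ≥0∞) := by
  change Measure.count.restrict φ.carrier B = _
  rw [Measure.restrict_apply hB, Measure.count_apply (hB.inter φ.countable.measurableSet),
    Set.inter_comm]

theorem lintegral_pointKernel (φ : Config) (f : Plane → ℝ≥0∞) :
    ∫⁻ x, f x ∂pointKernel φ = ∑' x : φ.carrier, f x := by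
  change ∫⁻ x in φ.carrier, f x ∂Measure.count = _
  rw [lintegral_countable f φ.countable]
  simp

/-- The planar annuli `{n ≤ ‖x‖ < n + 1}`. -/
def annulus (n : ℕ) : Set Plane := {x | ⌊‖x‖⌋₊ = n}

theorem measurableSet_annulus (n : ℕ) : MeasurableSet (annulus n) :=
  (measurableSet_singleton n).preimage (Nat.measurable_floor.comp measurable_norm)

theorem isBounded_annulus (n : ℕ) : Bornology.IsBounded (annulus n) := by
  refine (Metric.isBounded_closedBall (x := (0 : Plane)) (r := n + 1)).subset fun x hx => ?_
  rw [mem_closedBall_zero_iff]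
  have : ⌊‖x‖⌋₊ = n := hx
  rw [← this]
  exact (Nat.lt_floor_add_one _).le

/-- Counts are not uniformly bounded even on a bounded set, so the kernel is cut both by annulus `n`
and by the value `k` of the count there; each piece has total mass at most `k`. -/
instance : ProbabilityTheory.IsSFiniteKernel pointKernel := by
  classical
  have hA (n k : ℕ) : MeasurableSet {φ : Config | pointKernel φ (annulus n) = k} :=
    (measurableSet_singleton _).preimage
      (pointKernel.measurable_coe (measurableSet_annulus n))
  let κ (p : ℕ × ℕ) : ProbabilityTheory.Kernel Config Plane :=
    ProbabilityTheory.Kernel.piecewise (hA p.1 p.2)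
      (pointKernel.restrict (measurableSet_annulus p.1)) 0
  have hfin (p : ℕ × ℕ) : ProbabilityTheory.IsFiniteKernel (κ p) := by
    refine ⟨p.2, by simp, fun φ => ?_⟩
    rw [ProbabilityTheory.Kernel.piecewise_apply']
    split_ifs with h
    · rw [ProbabilityTheory.Kernel.restrict_apply, Measure.restrict_apply_univ]
      exact le_of_eq h
    · simp
  have hsum : pointKernel = ProbabilityTheory.Kernel.sum κ := by
    ext φ B hB
    rw [ProbabilityTheory.Kernel.sum_apply' _ _ hB, ENNReal.tsum_prod (f := fun n k => κ (n, k) φ B)]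
    have h1 (n : ℕ) : ∑' k : ℕ, κ (n, k) φ B = pointKernel φ (B ∩ annulus n) := by
      obtain ⟨k, hk⟩ : ∃ k : ℕ, pointKernel φ (annulus n) = k := by
        rw [pointKernel_apply φ (measurableSet_annulus n)]
        obtain ⟨k, hk⟩ := ENat.ne_top_iff_exists.1
          (φ.locallyFinite _ (isBounded_annulus n)).encard_lt_top.ne
        exact ⟨k, by rw [← hk]; simp⟩
      rw [tsum_eq_single k]
      · rw [ProbabilityTheory.Kernel.piecewise_apply', if_pos (by exact hk),
          ProbabilityTheory.Kernel.restrict_apply, Measure.restrict_apply hB]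
      · intro k' hk'
        rw [ProbabilityTheory.Kernel.piecewise_apply', if_neg]
        · simp
        · intro h
          have h' : (k' : ℝ≥0∞) = k := by
            rw [← hk]; exact Eq.symm h
          exact hk' (by exact_mod_cast h')
    simp_rw [h1]
    rw [← measure_iUnion]
    · congr 1
      rw [← Set.inter_iUnion]
      have : ⋃ n, annulus n = Set.univ := by
        ext x; simp [annulus]
      rw [this, Set.inter_univ]
    · intro i j hij
      refine Disjoint.mono Set.inter_subset_right Set.inter_subset_right ?_
      rw [Set.disjoint_left]
      intro x hx hx'
      exact hij (Eq.trans (Eq.symm hx) hx')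
    · exact fun n => hB.inter (measurableSet_annulus n)
  rw [hsum]
  infer_instance

/-- The bounded Borel sets. -/
def boundedBorel : Set (Set Plane) := {B | MeasurableSet B ∧ Bornology.IsBounded B}

/-- A count on `B` is the increasing limit of the counts on `B ∩ ball 0 n`. Bounded sets have finite
area, so their counts have genuine Poisson laws. -/
theorem measurableSpace_eq_bounded :
    Config.instMeasurableSpace = ⨆ B ∈ boundedBorel,
      MeasurableSpace.comap (pointCount Config.carrier B) inferInstance := by
  apply le_antisymm
  · refine iSup₂_le fun B hB => ?_
    set m : MeasurableSpace Config := ⨆ B ∈ boundedBorel,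
      MeasurableSpace.comap (pointCount Config.carrier B) inferInstance with hm
    rw [← measurable_iff_comap_le]
    have hb (n : ℕ) : B ∩ Metric.ball 0 n ∈ boundedBorel :=
      ⟨hB.inter measurableSet_ball, Metric.isBounded_ball.subset Set.inter_subset_right⟩
    have h1 (n : ℕ) : Measurable[m] (fun φ : Config => pointKernel φ (B ∩ Metric.ball 0 n)) := by
      have : (fun φ : Config => pointKernel φ (B ∩ Metric.ball 0 n)) =
          (fun k : ℕ∞ => (k : ℝ≥0∞)) ∘
            pointCount Config.carrier (B ∩ Metric.ball 0 n) := by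
        funext φ
        exact pointKernel_apply φ (hb n).1
      rw [this]
      refine (Measurable.of_discrete (f := fun n : ℕ∞ => (n : ℝ≥0∞))).comp ?_
      exact Measurable.of_comap_le (le_iSup₂_of_le (f := fun B (_ : B ∈ boundedBorel) =>
        MeasurableSpace.comap (pointCount Config.carrier B) inferInstance)
        _ (hb n) le_rfl)
    have h2 : Measurable[m] (fun φ : Config => pointKernel φ B) := by
      have : (fun φ : Config => pointKernel φ B)
          = fun φ => ⨆ n : ℕ, pointKernel φ (B ∩ Metric.ball 0 n) := by
        funext φ
        rw [← Monotone.measure_iUnion, ← Set.inter_iUnion, Metric.iUnion_ball_nat, Set.inter_univ]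
        intro i j hij
        exact Set.inter_subset_inter_right _ (Metric.ball_subset_ball (by exact_mod_cast hij))
      rw [this]
      exact Measurable.iSup h1
    refine @ENat.measurable_iff _ m _ |>.2 fun k => ?_
    have : pointCount Config.carrier B ⁻¹' {(k : ℕ∞)}
        = (fun φ : Config => pointKernel φ B) ⁻¹' {(k : ℝ≥0∞)} := by
      ext φ
      simp only [Set.mem_preimage, Set.mem_singleton_iff, pointKernel_apply φ hB, pointCount]
      exact_mod_cast Iff.rfl
    rw [this]
    exact h2 (measurableSet_singleton _)
  · exact iSup₂_le fun B hB => le_iSup₂_of_le B hB.1 le_rfl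

end Config

/-! ### The law of a Poisson process on configurations -/

namespace IsPoissonProcess

variable {Ω : Type*} [MeasurableSpace Ω] {μ : Measure Ω} {X : Ω → Set Plane} {lam : ℝ≥0}

/-- A Poisson process as a random configuration. -/
def toConfig (hX : IsPoissonProcess μ X lam) (ω : Ω) : Config := ⟨X ω, hX.locallyFinite ω⟩

theorem comap_toConfig (hX : IsPoissonProcess μ X lam) :
    Config.instMeasurableSpace.comap hX.toConfig = pointSigma X := by
  simp only [Config.instMeasurableSpace, pointSigma, MeasurableSpace.comap_iSup,
    MeasurableSpace.comap_comp]
  rfl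

theorem measurable_toConfig (hX : IsPoissonProcess μ X lam) : Measurable hX.toConfig := by
  rw [measurable_iff_comap_le, comap_toConfig]
  exact iSup₂_le fun B hB => (hX.measurable_count B hB).comap_le

/-- The law of a Poisson process. -/
noncomputable def law (hX : IsPoissonProcess μ X lam) : Measure Config := μ.map hX.toConfig

theorem isPoissonProcess_law (hX : IsPoissonProcess μ X lam) :
    IsPoissonProcess hX.law Config.carrier lam where
  locallyFinite φ := φ.locallyFinite
  measurable_count B hB := Config.measurable_pointCount hB
  count_law B hB hv k := by
    rw [← hX.count_law B hB hv k, law, Measure.map_apply hX.measurable_toConfig]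
    · rfl
    · exact (Config.measurable_pointCount hB) (measurableSet_singleton _)
  count_indep n B hB hd := by
    have h := hX.count_indep n B hB hd
    rw [ProbabilityTheory.iIndepFun_iff_measure_inter_preimage_eq_mul] at h ⊢
    intro S s hs
    have h' := h S hs
    rw [law, Measure.map_apply hX.measurable_toConfig
      (S.measurableSet_biInter fun i hi => Config.measurable_pointCount (hB i) (hs i hi))]
    simp only [Set.preimage_iInter]
    refine Eq.trans h' (Finset.prod_congr rfl fun i hi => ?_)
    rw [Measure.map_apply hX.measurable_toConfig (Config.measurable_pointCount (hB i) (hs i hi))]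
    rfl

end IsPoissonProcess

/-! ### The Poisson distribution and the Chen–Stein identity -/

/-- The Poisson distribution on `ℕ∞`. -/
noncomputable def poissonENat (m : ℝ≥0) : Measure ℕ∞ :=
  (ProbabilityTheory.poissonMeasure m).map Nat.cast

instance (m : ℝ≥0) : IsProbabilityMeasure (poissonENat m) :=
  inferInstanceAs (IsProbabilityMeasure ((ProbabilityTheory.poissonMeasure m).map Nat.cast))

theorem lintegral_poissonENat (m : ℝ≥0) (h : ℕ∞ → ℝ≥0∞) :
    ∫⁻ n, h n ∂poissonENat m
      = ∑' k : ℕ, h k * ENNReal.ofReal (Real.exp (-m) * m ^ k / k.factorial) := by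
  rw [poissonENat, lintegral_map .of_discrete .of_discrete, lintegral_countable']
  simp_rw [ProbabilityTheory.poissonMeasure_singleton]

/-- The Chen–Stein identity. -/
theorem lintegral_mul_poissonENat (m : ℝ≥0) (h : ℕ∞ → ℝ≥0∞) :
    ∫⁻ n, (n : ℝ≥0∞) * h n ∂poissonENat m = m * ∫⁻ n, h (n + 1) ∂poissonENat m := by
  rw [lintegral_poissonENat, lintegral_poissonENat, tsum_eq_zero_add' ENNReal.summable,
    ← ENNReal.tsum_mul_left]
  simp only [Nat.cast_zero, ENat.toENNReal_zero, zero_mul, zero_add]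
  refine tsum_congr fun k => ?_
  have h1 : ENNReal.ofReal (Real.exp (-m) * m ^ (k + 1) / (k + 1).factorial) * (k + 1 : ℝ≥0∞)
      = m * ENNReal.ofReal (Real.exp (-m) * m ^ k / k.factorial) := by
    have h2 : (k + 1 : ℝ≥0∞) = ENNReal.ofReal (k + 1) := by
      rw [ENNReal.ofReal_add (by positivity) (by positivity)]; simp
    have h3 : (m : ℝ≥0∞) = ENNReal.ofReal m := by simp
    rw [h2, h3, ← ENNReal.ofReal_mul (by positivity), ← ENNReal.ofReal_mul (by positivity)]
    congr 1
    rw [Nat.factorial_succ]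
    push_cast
    field_simp
    ring
  push_cast
  rw [mul_comm (k + 1 : ℝ≥0∞), mul_assoc, mul_comm (k + 1 : ℝ≥0∞), h1]
  ring

/-- Integrating over coordinate `s` first reduces this to the one-dimensional identity with the
other coordinates frozen. -/
theorem lintegral_mul_pi_poissonENat {ι : Type*} [Fintype ι] [DecidableEq ι] (m : ι → ℝ≥0)
    (s : ι) (h : (ι → ℕ∞) → ℝ≥0∞) :
    ∫⁻ n, (n s : ℝ≥0∞) * h n ∂Measure.pi (fun t => poissonENat (m t))
      = m s * ∫⁻ n, h (n + Pi.single s 1) ∂Measure.pi (fun t => poissonENat (m t)) := by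
  have hd : ∀ f : (ι → ℕ∞) → ℝ≥0∞, Measurable f := fun f => measurable_of_countable f
  rw [← lintegral_const_mul _ (hd _), lintegral_eq_lmarginal_univ 0, lintegral_eq_lmarginal_univ 0,
    lmarginal_erase' _ (hd _) (Finset.mem_univ s), lmarginal_erase' _ (hd _) (Finset.mem_univ s)]
  congr 2
  funext x
  have h1 := lintegral_mul_poissonENat (m s) fun k => h (Function.update x s k)
  rw [lintegral_const_mul _ (.of_discrete)]
  simp only [Function.update_self]
  rw [h1]
  congr 2
  funext k
  congr 1
  funext t
  by_cases ht : t = s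
  · subst ht; simp
  · simp [ht]

/-! ### Laws of counts on finite partitions -/

namespace IsPoissonProcess

variable {Ω : Type*} [MeasurableSpace Ω] {μ : Measure Ω} [IsProbabilityMeasure μ]
  {X : Ω → Set Plane} {lam : ℝ≥0}

theorem map_pointCount (hX : IsPoissonProcess μ X lam) {B : Set Plane} (hB : MeasurableSet B)
    (hv : volume B ≠ ∞) :
    μ.map (pointCount X B) = poissonENat (lam * (volume B).toNNReal) := by
  have : IsProbabilityMeasure (μ.map (pointCount X B)) :=
    Measure.isProbabilityMeasure_map (hX.measurable_count B hB).aemeasurable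
  have hk (k : ℕ) : μ.map (pointCount X B) {(k : ℕ∞)}
      = poissonENat (lam * (volume B).toNNReal) {(k : ℕ∞)} := by
    rw [Measure.map_apply (hX.measurable_count B hB) (measurableSet_singleton _), poissonENat,
      Measure.map_apply .of_discrete (measurableSet_singleton _)]
    have h1 : (Nat.cast : ℕ → ℕ∞) ⁻¹' {(k : ℕ∞)} = {k} := by ext; simp
    rw [h1, ← hX.count_law B hB hv k]
    rfl
  -- `count_law` gives the masses of finite values only; total mass one forces the mass at `⊤`.
  have htop (ρ : Measure ℕ∞) [IsProbabilityMeasure ρ] :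
      ρ {⊤} = 1 - ∑' k : ℕ, ρ {(k : ℕ∞)} := by
    have h1 : ({⊤} : Set ℕ∞) = (⋃ k : ℕ, {(k : ℕ∞)})ᶜ := by
      ext n; induction n using ENat.recTopCoe <;> simp
    rw [h1, prob_compl_eq_one_sub .of_discrete, measure_iUnion _ fun _ => .of_discrete]
    intro i j hij
    simpa using hij
  refine Measure.ext_of_singleton fun n => ?_
  induction n using ENat.recTopCoe with
  | top => simp_rw [htop, hk]
  | coe k => exact hk k

theorem lintegral_pointCount (hX : IsPoissonProcess μ X lam) {B : Set Plane}
    (hB : MeasurableSet B) (hv : volume B ≠ ∞) (h : ℕ∞ → ℝ≥0∞) :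
    ∫⁻ ω, h (pointCount X B ω) ∂μ = ∫⁻ n, h n ∂poissonENat (lam * (volume B).toNNReal) := by
  rw [← hX.map_pointCount hB hv, lintegral_map .of_discrete (hX.measurable_count B hB)]

theorem ae_pointCount_eq_zero (hX : IsPoissonProcess μ X lam) {B : Set Plane}
    (hB : MeasurableSet B) (hv : volume B = 0) : ∀ᵐ ω ∂μ, pointCount X B ω = 0 := by
  rw [← ae_map_iff (p := fun n : ℕ∞ => n = 0) (hX.measurable_count B hB).aemeasurable .of_discrete,
    hX.map_pointCount hB (by simp [hv]), poissonENat, ae_map_iff (Measurable.of_discrete).aemeasurable .of_discrete,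
    ae_iff_of_countable]
  intro k hk
  by_contra h0
  apply hk
  rw [ProbabilityTheory.poissonMeasure_singleton]
  have : k ≠ 0 := by simpa using h0
  simp [hv, this]

theorem ae_notMem (hX : IsPoissonProcess μ X lam) (x : Plane) : ∀ᵐ ω ∂μ, x ∉ X ω := by
  filter_upwards [hX.ae_pointCount_eq_zero (measurableSet_singleton x) (by simp)] with ω h hx
  rw [pointCount, Set.encard_eq_zero] at h
  exact (Set.ext_iff.1 h x).1 ⟨hx, rfl⟩

theorem map_fibre_counts (hX : IsPoissonProcess μ X lam) {ι : Type*} [Fintype ι] {b : Plane → ι}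
    (hb : ∀ s, MeasurableSet (b ⁻¹' {s})) {K : Set Plane} (hK : MeasurableSet K)
    (hv : volume K ≠ ∞) :
    μ.map (fun ω s => pointCount X (K ∩ b ⁻¹' {s}) ω)
      = Measure.pi fun s => poissonENat (lam * (volume (K ∩ b ⁻¹' {s})).toNNReal) := by
  have hm (s : ι) : MeasurableSet (K ∩ b ⁻¹' {s}) := hK.inter (hb s)
  have hvs (s : ι) : volume (K ∩ b ⁻¹' {s}) ≠ ∞ := measure_ne_top_of_subset Set.inter_subset_left hv
  have hind : ProbabilityTheory.iIndepFun (fun s => pointCount X (K ∩ b ⁻¹' {s})) μ := by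
    let e := Fintype.equivFin ι
    have h := hX.count_indep _ (fun i => K ∩ b ⁻¹' {e.symm i}) (fun i => hm _) (by
      intro i j hij
      rw [Set.disjoint_left]
      rintro x ⟨_, hx⟩ ⟨_, hx'⟩
      exact hij (e.symm.injective (Eq.trans (Eq.symm hx) hx')))
    have h2 := h.precomp e.injective
    simpa using h2
  rw [hind.map_fun_eq_pi_map fun s => (hX.measurable_count _ (hm s)).aemeasurable]
  congr 1
  funext s
  exact hX.map_pointCount (hm s) (hvs s)

end IsPoissonProcess

/-! ### Cylinder events and uniqueness of the Poisson law -/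

namespace Config

/-- The events that finitely many counts on bounded Borel sets belong to prescribed sets. -/
def cylinders : Set (Set Config) :=
  piiUnionInter (fun B => {E | MeasurableSet[MeasurableSpace.comap
    (pointCount Config.carrier B) inferInstance] E}) boundedBorel

theorem generateFrom_cylinders : MeasurableSpace.generateFrom cylinders = Config.instMeasurableSpace := by
  rw [measurableSpace_eq_bounded]
  exact generateFrom_piiUnionInter_measurableSet _ _

theorem isPiSystem_cylinders : IsPiSystem cylinders :=
  isPiSystem_piiUnionInter _ (fun _ => @MeasurableSpace.isPiSystem_measurableSet _ (_)) _

theorem univ_mem_cylinders : Set.univ ∈ cylinders :=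
  ⟨∅, by simp, fun _ => Set.univ, by simp, by simp⟩

theorem pointCount_biUnion {ι : Type*} (φ : Config) (b : Plane → ι) (K : Set Plane)
    (J : Finset ι) (hm : ∀ s, MeasurableSet (K ∩ b ⁻¹' {s})) :
    pointCount carrier (K ∩ b ⁻¹' J) φ = ∑ s ∈ J, pointCount carrier (K ∩ b ⁻¹' {s}) φ := by
  have h1 : K ∩ b ⁻¹' J = ⋃ s ∈ J, K ∩ b ⁻¹' {s} := by ext x; simp
  have h2 : pointKernel φ (K ∩ b ⁻¹' J) = ∑ s ∈ J, pointKernel φ (K ∩ b ⁻¹' {s}) := by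
    rw [h1, measure_biUnion_finset _ fun s _ => hm s]
    intro s _ t _ hst
    change Disjoint (K ∩ b ⁻¹' {s}) (K ∩ b ⁻¹' {t})
    rw [Set.disjoint_left]
    rintro x ⟨_, hx⟩ ⟨_, hx'⟩
    exact hst (Eq.trans (Eq.symm hx) hx')
  have h3 : MeasurableSet (K ∩ b ⁻¹' J) := by
    rw [h1]; exact J.measurableSet_biUnion fun s _ => hm s
  rw [pointKernel_apply φ h3] at h2
  simp_rw [fun s => pointKernel_apply φ (hm s)] at h2
  have h4 : ((∑ s ∈ J, pointCount carrier (K ∩ b ⁻¹' {s}) φ : ℕ∞) : ℝ≥0∞)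
      = ∑ s ∈ J, (pointCount carrier (K ∩ b ⁻¹' {s}) φ : ℝ≥0∞) :=
    map_sum ENat.toENNRealRingHom _ _
  exact ENat.toENNReal_inj.1 (h2.trans h4.symm)

/-- Label each point by which sets among `D` and those defining `E` contain it. Each of these sets
is then a union of label fibres inside their total union `K`, so its count is a sum of counts on
disjoint sets. No measurability of `U` is demanded, since `ι → ℕ∞` is countable. -/
theorem exists_fibres {E : Set Config} (hE : E ∈ cylinders) {D : Set Plane}
    (hD : D ∈ boundedBorel) :
    ∃ (ι : Type) (_ : Fintype ι) (b : Plane → ι) (K : Set Plane) (J : Finset ι)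
      (U : Set (ι → ℕ∞)), (∀ s, MeasurableSet (b ⁻¹' {s})) ∧ K ∈ boundedBorel ∧
        D = K ∩ b ⁻¹' J ∧ E = {φ | (fun s => pointCount carrier (K ∩ b ⁻¹' {s}) φ) ∈ U} := by
  classical
  obtain ⟨t, ht, f, hf, rfl⟩ := hE
  have hf' : ∀ B, ∃ V : Set ℕ∞, B ∈ t → pointCount carrier B ⁻¹' V = f B := by
    intro B
    by_cases hB : B ∈ t
    · obtain ⟨V, -, hV⟩ := hf B hB
      exact ⟨V, fun _ => hV⟩
    · exact ⟨∅, fun h => absurd h hB⟩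
  choose V hV using hf'
  let t' := insert D t
  have ht' : ∀ B ∈ t', B ∈ boundedBorel := by
    intro B hB
    rcases Finset.mem_insert.1 hB with rfl | h
    · exact hD
    · exact ht h
  let b : Plane → Set t' := fun x => {B | x ∈ B.1}
  let K : Set Plane := ⋃ B ∈ t', B
  have hK : K ∈ boundedBorel :=
    ⟨t'.measurableSet_biUnion fun B hB => (ht' B hB).1,
      (Bornology.isBounded_biUnion_finset t').2 fun B hB => (ht' B hB).2⟩
  have hb : ∀ s, MeasurableSet (b ⁻¹' {s}) := by
    intro s
    have : b ⁻¹' {s} = ⋂ B : t', {x | x ∈ B.1 ↔ B ∈ s} := by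
      ext x
      simp only [Set.mem_preimage, Set.mem_singleton_iff, Set.mem_iInter, b, Set.ext_iff]
      rfl
    rw [this]
    refine MeasurableSet.iInter fun B => ?_
    by_cases h : B ∈ s
    · simpa [h] using (ht' B.1 B.2).1
    · simp only [h, iff_false]
      exact (ht' B.1 B.2).1.compl
  have hsub : ∀ B (hB : B ∈ t'),
      B = K ∩ b ⁻¹' (Finset.univ.filter fun s : Set t' => (⟨B, hB⟩ : t') ∈ s : Finset (Set t')) := by
    intro B hB
    ext x
    simp only [Finset.coe_filter, Finset.mem_univ, true_and, Set.mem_inter_iff, Set.mem_preimage, b]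
    exact ⟨fun h => ⟨Set.mem_biUnion hB h, h⟩, fun h => h.2⟩
  refine ⟨Set t', inferInstance, b, K, _,
    {n | ∀ (B : Set Plane) (hB : B ∈ t),
      ∑ s ∈ (Finset.univ.filter fun s : Set t' => (⟨B, Finset.mem_insert_of_mem hB⟩ : t') ∈ s),
        n s ∈ V B}, hb, hK, hsub D (Finset.mem_insert_self _ _), ?_⟩
  ext φ
  simp only [Set.mem_iInter]
  refine forall₂_congr fun B hB => ?_
  rw [← hV B hB, ← pointCount_biUnion φ b K _ fun s => hK.1.inter (hb s),
    ← hsub B (Finset.mem_insert_of_mem hB)]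
  rfl

theorem generateFrom_boundedBorel :
    MeasurableSpace.generateFrom boundedBorel = (inferInstance : MeasurableSpace Plane) := by
  apply le_antisymm
  · exact MeasurableSpace.generateFrom_le fun B hB => hB.1
  · intro B hB
    have : B = ⋃ n : ℕ, B ∩ Metric.ball 0 n := by
      rw [← Set.inter_iUnion, Metric.iUnion_ball_nat, Set.inter_univ]
    rw [this]
    refine MeasurableSet.iUnion fun n => MeasurableSpace.measurableSet_generateFrom
      ⟨hB.inter measurableSet_ball, Metric.isBounded_ball.subset Set.inter_subset_right⟩

theorem isPiSystem_boundedBorel : IsPiSystem boundedBorel :=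
  fun _ hB _ hC _ => ⟨hB.1.inter hC.1, hB.2.subset Set.inter_subset_left⟩

theorem ball_mem_boundedBorel (n : ℕ) : Metric.ball (0 : Plane) n ∈ boundedBorel :=
  ⟨measurableSet_ball, Metric.isBounded_ball⟩

theorem measurable_iff {α : Type*} [MeasurableSpace α] {f : α → Config} :
    Measurable f ↔ ∀ B, MeasurableSet B → Measurable fun a => pointCount carrier B (f a) := by
  refine ⟨fun h B hB => (measurable_pointCount hB).comp h, fun h => ?_⟩
  rw [measurable_iff_comap_le]
  simp only [Config.instMeasurableSpace, pointSigma, MeasurableSpace.comap_iSup,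
    MeasurableSpace.comap_comp]
  exact iSup₂_le fun B hB => (h B hB).comap_le

end Config

/-- On a cylinder both measures are computed from the joint law of fibre counts, which depends only
on `lam`. -/
theorem IsPoissonProcess.measure_eq {P Q : Measure Config} [IsProbabilityMeasure P]
    [IsProbabilityMeasure Q] {lam : ℝ≥0} (hP : IsPoissonProcess P Config.carrier lam)
    (hQ : IsPoissonProcess Q Config.carrier lam) : P = Q := by
  refine ext_of_generate_finite _ Config.generateFrom_cylinders.symm Config.isPiSystem_cylinders
    (fun E hE => ?_) (by simp)
  obtain ⟨ι, _, b, K, J, U, hb, hK, -, rfl⟩ :=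
    Config.exists_fibres hE (Config.ball_mem_boundedBorel 0)
  have hU : MeasurableSet U := U.to_countable.measurableSet
  have hm : Measurable fun (φ : Config) s => pointCount Config.carrier (K ∩ b ⁻¹' {s}) φ :=
    measurable_pi_lambda _ fun s => Config.measurable_pointCount (hK.1.inter (hb s))
  have h1 := hP.map_fibre_counts hb hK.1 hK.2.measure_lt_top.ne
  rw [← hQ.map_fibre_counts hb hK.1 hK.2.measure_lt_top.ne] at h1
  have h2 := congrArg (fun ρ => ρ U) h1
  simp only [Measure.map_apply hm hU] at h2
  exact h2

/-! ### Adding a point, and the Mecke formula -/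

namespace Config

/-- The configuration `φ` with the point `x` added. -/
def addPoint (φ : Config) (x : Plane) : Config where
  carrier := insert x φ.carrier
  locallyFinite B hB :=
    ((φ.locallyFinite B hB).insert x).subset (by
      rintro y ⟨rfl | hy, hB⟩
      · exact Set.mem_insert _ _
      · exact Set.mem_insert_of_mem _ ⟨hy, hB⟩)

theorem measurableSet_mem_carrier :
    MeasurableSet {p : Config × Plane | p.2 ∈ p.1.carrier} := by
  have h := ProbabilityTheory.Kernel.measurable_kernel_prodMk_left
    (κ := pointKernel.comap Prod.fst (measurable_fst (α := Config) (β := Plane)))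
    (t := {q : (Config × Plane) × Plane | q.2 = q.1.2})
    (measurableSet_eq_fun measurable_snd (measurable_snd.comp measurable_fst))
  convert (measurableSet_singleton (0 : ℝ≥0∞)).compl.preimage h using 1
  ext ⟨φ, x⟩
  have h1 : Prod.mk (φ, x) ⁻¹' {q : (Config × Plane) × Plane | q.2 = q.1.2} = {x} := by
    ext; simp
  simp only [Set.mem_preimage, Set.mem_compl_iff, Set.mem_singleton_iff,
    ProbabilityTheory.Kernel.comap_apply, h1, pointKernel_apply φ (measurableSet_singleton x),
    Set.mem_ofPred_eq]
  simp

theorem pointCount_addPoint {φ : Config} {x : Plane} (hx : x ∉ φ.carrier) (B : Set Plane)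
    [Decidable (x ∈ B)] :
    pointCount carrier B (φ.addPoint x)
      = pointCount carrier B φ + if x ∈ B then 1 else 0 := by
  unfold pointCount addPoint
  split_ifs with h
  · rw [Set.insert_inter_of_mem h, Set.encard_insert_of_notMem fun h' => hx h'.1]
  · rw [Set.insert_inter_of_notMem h, add_zero]

theorem addPoint_of_mem {φ : Config} {x : Plane} (hx : x ∈ φ.carrier) : φ.addPoint x = φ := by
  cases φ
  simpa [addPoint] using hx

theorem measurable_addPoint : Measurable fun p : Config × Plane => p.1.addPoint p.2 := by
  classical
  refine measurable_iff.2 fun B hB => ?_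
  -- Adding a point already present changes nothing, so the count has to be split according to
  -- membership.
  have : (fun p : Config × Plane => pointCount carrier B (p.1.addPoint p.2))
      = fun p => if p ∈ {p : Config × Plane | p.2 ∈ p.1.carrier} then pointCount carrier B p.1
        else pointCount carrier B p.1 + if p.2 ∈ B then 1 else 0 := by
    funext p
    split_ifs with h1 h2
    · rw [addPoint_of_mem h1]
    · rw [pointCount_addPoint h1, if_pos h2]
    · rw [pointCount_addPoint h1, if_neg h2]
  rw [this]
  have h1 : Measurable fun p : Config × Plane => pointCount carrier B p.1 :=
    (measurable_pointCount hB).comp measurable_fst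
  refine Measurable.ite measurableSet_mem_carrier h1 ?_
  exact (Measurable.of_discrete (f := fun q : ℕ∞ × ℕ∞ => q.1 + q.2)).comp
    (h1.prodMk (Measurable.ite (measurable_snd hB) measurable_const measurable_const))

end Config

namespace IsPoissonProcess

open Config

variable {P : Measure Config} [IsProbabilityMeasure P] {lam : ℝ≥0}

/-- This is the Mecke formula on rectangles. For each fibre, Chen–Stein shifts its count by one on
the left; on the right, adding a point of the fibre, almost surely a new one, causes the same shift.
-/
theorem setLIntegral_pointKernel (hP : IsPoissonProcess P carrier lam) {E : Set Config}
    (hE : E ∈ cylinders) {D : Set Plane} (hD : D ∈ boundedBorel) :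
    ∫⁻ φ in E, pointKernel φ D ∂P = lam * ∫⁻ x in D, P {φ | φ.addPoint x ∈ E} := by
  classical
  obtain ⟨ι, _, b, K, J, U, hb, hK, rfl, rfl⟩ := exists_fibres hE hD
  have hm (s : ι) : MeasurableSet (K ∩ b ⁻¹' {s}) := hK.1.inter (hb s)
  have hv (s : ι) : volume (K ∩ b ⁻¹' {s}) ≠ ∞ :=
    measure_ne_top_of_subset Set.inter_subset_left hK.2.measure_lt_top.ne
  set N : Config → ι → ℕ∞ := fun φ s => pointCount carrier (K ∩ b ⁻¹' {s}) φ with hN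
  have hNm : Measurable N := measurable_pi_lambda _ fun s => measurable_pointCount (hm s)
  have hU : MeasurableSet U := U.to_countable.measurableSet
  have hd (f : (ι → ℕ∞) → ℝ≥0∞) : Measurable f := measurable_of_countable f
  have hlaw := hP.map_fibre_counts hb hK.1 hK.2.measure_lt_top.ne
  set π := Measure.pi fun s => poissonENat (lam * (volume (K ∩ b ⁻¹' {s})).toNNReal) with hπ
  have hleft (s : ι) : ∫⁻ φ in N ⁻¹' U, (N φ s : ℝ≥0∞) ∂P
      = (lam * volume (K ∩ b ⁻¹' {s})) * P {φ | N φ + Pi.single s 1 ∈ U} := by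
    rw [← lintegral_indicator (hNm hU)]
    have h1 : (N ⁻¹' U).indicator (fun φ => (N φ s : ℝ≥0∞))
        = fun φ => (fun n : ι → ℕ∞ => (n s : ℝ≥0∞) * U.indicator 1 n) (N φ) := by
      funext φ
      by_cases h : N φ ∈ U
      · simp [h]
      · simp [h]
    rw [h1, ← lintegral_map (hd _) hNm, hlaw, lintegral_mul_pi_poissonENat, ← hπ, ← hlaw,
      lintegral_map (hd _) hNm]
    congr 1
    · rw [ENNReal.coe_mul, ENNReal.coe_toNNReal (hv s)]
    · rw [← lintegral_indicator_one]
      · rfl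
      · exact hNm (Set.to_countable {n | n + Pi.single s 1 ∈ U}).measurableSet
  have hright (s : ι) : ∫⁻ x in K ∩ b ⁻¹' {s}, P {φ | N (φ.addPoint x) ∈ U}
      = volume (K ∩ b ⁻¹' {s}) * P {φ | N φ + Pi.single s 1 ∈ U} := by
    rw [setLIntegral_congr_fun (g := fun _ => P {φ | N φ + Pi.single s 1 ∈ U}) (hm s),
      setLIntegral_const, mul_comm]
    intro x hx
    refine measure_congr ?_
    filter_upwards [hP.ae_notMem x] with φ hφ
    have : N (φ.addPoint x) = N φ + Pi.single s 1 := by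
      funext t
      simp only [hN, pointCount_addPoint hφ, Pi.add_apply]
      congr 1
      by_cases hts : t = s
      · subst hts; simp [hx]
      · have h2 : b x = s := hx.2
        simp [hts, h2, Ne.symm hts]
    change (N (φ.addPoint x) ∈ U) = (N φ + Pi.single s 1 ∈ U)
    rw [this]
  have hK1 : K ∩ b ⁻¹' J = ⋃ s ∈ J, K ∩ b ⁻¹' {s} := by ext x; simp
  have hsum (φ : Config) : pointKernel φ (K ∩ b ⁻¹' J) = ∑ s ∈ J, (N φ s : ℝ≥0∞) := by
    rw [pointKernel_apply φ (hK1 ▸ J.measurableSet_biUnion fun s _ => hm s)]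
    have := congrArg (fun n : ℕ∞ => (n : ℝ≥0∞)) (pointCount_biUnion φ b K J hm)
    refine this.trans (map_sum ENat.toENNRealRingHom _ _)
  simp_rw [hsum]
  have hNs (s : ι) : Measurable fun φ => (N φ s : ℝ≥0∞) :=
    (Measurable.of_discrete (f := fun n : ℕ∞ => (n : ℝ≥0∞))).comp (measurable_pointCount (hm s))
  rw [lintegral_finsetSum _ fun s _ => hNs s, hK1, lintegral_biUnion_finset _ fun s _ => hm s, Finset.mul_sum]
  · refine Finset.sum_congr rfl fun s _ => ?_
    refine (hleft s).trans ?_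
    rw [mul_assoc, ← hright s]
    rfl
  · intro s _ t _ hst
    change Disjoint (K ∩ b ⁻¹' {s}) (K ∩ b ⁻¹' {t})
    rw [Set.disjoint_left]
    rintro x ⟨_, hx⟩ ⟨_, hx'⟩
    exact hst (Eq.trans (Eq.symm hx) hx')

/-- The Mecke formula, as an identity between measures. -/
theorem compProd_pointKernel (hP : IsPoissonProcess P carrier lam) :
    P.compProd pointKernel
      = (lam : ℝ≥0∞) • (P.prod volume).map (fun p => (p.1.addPoint p.2, p.2)) := by
  have hsp : IsCountablySpanning cylinders :=
    ⟨fun _ => Set.univ, fun _ => univ_mem_cylinders, Set.iUnion_const _⟩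
  have hsp' : IsCountablySpanning boundedBorel :=
    ⟨fun n => Metric.ball 0 n, ball_mem_boundedBorel, Metric.iUnion_ball_nat 0⟩
  have hcm {E : Set Config} (hE : E ∈ cylinders) : MeasurableSet E := by
    rw [← generateFrom_cylinders]
    exact MeasurableSpace.measurableSet_generateFrom hE
  have key : ∀ E ∈ cylinders, ∀ D ∈ boundedBorel, P.compProd pointKernel (E ×ˢ D)
      = ((lam : ℝ≥0∞) • (P.prod volume).map
        (fun p : Config × Plane => (p.1.addPoint p.2, p.2))) (E ×ˢ D) := by
    intro E hE D hD
    have hmeas : Measurable fun p : Config × Plane => (p.1.addPoint p.2, p.2) :=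
      measurable_addPoint.prodMk measurable_snd
    rw [Measure.compProd_apply_prod (hcm hE) hD.1, hP.setLIntegral_pointKernel hE hD,
      Measure.smul_apply, smul_eq_mul, Measure.map_apply hmeas ((hcm hE).prod hD.1),
      Measure.prod_apply_symm (hmeas ((hcm hE).prod hD.1)), ← lintegral_indicator hD.1]
    congr 2
    funext x
    by_cases hx : x ∈ D
    · rw [Set.indicator_of_mem hx]
      congr 1
      ext φ
      simp [hx]
    · rw [Set.indicator_of_notMem hx, eq_comm]
      convert measure_empty (μ := P)
      ext φ
      simp [hx]
  -- Rectangles form a generating π-system, and the strips `univ ×ˢ ball 0 n` exhaust the product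
  -- with finite mass.
  refine Measure.ext_of_generateFrom_of_iUnion _ (fun n : ℕ => Set.univ ×ˢ Metric.ball 0 n)
    (generateFrom_eq_prod generateFrom_cylinders generateFrom_boundedBorel hsp hsp').symm
    (isPiSystem_cylinders.prod isPiSystem_boundedBorel) ?_ ?_ ?_ ?_
  · rw [← Set.prod_iUnion, Metric.iUnion_ball_nat, Set.univ_prod_univ]
  · exact fun n => ⟨_, univ_mem_cylinders, _, ball_mem_boundedBorel n, rfl⟩
  · intro n
    rw [Measure.compProd_apply_prod .univ measurableSet_ball,
      hP.setLIntegral_pointKernel univ_mem_cylinders (ball_mem_boundedBorel n)]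
    simp only [Set.mem_univ, Set.ofPred_true, measure_univ, lintegral_const,
      Measure.restrict_apply_univ, one_mul]
    exact ENNReal.mul_ne_top ENNReal.coe_ne_top measure_ball_lt_top.ne
  · rintro _ ⟨E, hE, D, hD, rfl⟩
    exact key E hE D hD

/-- The Mecke formula. -/
theorem lintegral_lintegral_pointKernel (hP : IsPoissonProcess P carrier lam)
    {f : Config → Plane → ℝ≥0∞} (hf : Measurable (Function.uncurry f)) :
    ∫⁻ φ, ∫⁻ x, f φ x ∂pointKernel φ ∂P = lam * ∫⁻ x, ∫⁻ φ, f (φ.addPoint x) x ∂P := by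
  have h1 := Measure.lintegral_compProd (μ := P) (κ := pointKernel) hf
  have hmeas : Measurable fun p : Config × Plane => (p.1.addPoint p.2, p.2) :=
    measurable_addPoint.prodMk measurable_snd
  rw [hP.compProd_pointKernel, lintegral_smul_measure, lintegral_map hf hmeas,
    lintegral_prod_symm' (fun p : Config × Plane => Function.uncurry f (p.1.addPoint p.2, p.2))
      (hf.comp hmeas)] at h1
  exact h1.symm

end IsPoissonProcess

/-! ### Measurability of Voronoi cells and of counts in them -/

namespace Config

/-- Membership means that no configuration point other than `x` is at least as close to `y` as `x`
is, so it is the vanishing of the counting kernel on a measurable section. -/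
theorem measurableSet_mem_voronoiCell :
    MeasurableSet {q : (Config × Plane) × Plane | q.2 ∈ voronoiCell q.1.1.carrier q.1.2} := by
  let t : Set (((Config × Plane) × Plane) × Plane) :=
    {r | dist r.1.2 r.2 ≤ dist r.1.2 r.1.1.2} ∩ {r | r.2 = r.1.1.2}ᶜ
  have ht : MeasurableSet t := by
    refine (measurableSet_le ?_ ?_).inter (measurableSet_eq_fun ?_ ?_).compl <;> fun_prop
  have h := ProbabilityTheory.Kernel.measurable_kernel_prodMk_left
    (κ := pointKernel.comap (fun q : (Config × Plane) × Plane => q.1.1) (by fun_prop)) ht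
  convert (measurableSet_singleton (0 : ℝ≥0∞)).preimage h using 1
  ext ⟨⟨φ, x⟩, y⟩
  simp only [Set.mem_preimage, Set.mem_singleton_iff,
    ProbabilityTheory.Kernel.comap_apply, Set.mem_ofPred_eq, voronoiCell]
  rw [pointKernel_apply φ (measurable_prodMk_left ht), ENat.toENNReal_eq_zero,
    Set.encard_eq_zero, Set.eq_empty_iff_forall_notMem]
  refine forall_congr' fun z => ?_
  simp only [t, Set.mem_inter_iff, Set.mem_preimage, Set.mem_ofPred_eq, Set.mem_compl_iff, not_and,
    not_not, ← not_lt]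
  tauto

theorem measurableSet_voronoiCell (φ : Config) (x : Plane) :
    MeasurableSet (voronoiCell φ.carrier x) :=
  measurable_prodMk_left (x := (φ, x)) measurableSet_mem_voronoiCell

theorem measurable_volume_voronoiCell :
    Measurable fun p : Config × Plane => volume (voronoiCell p.1.carrier p.2) :=
  measurable_measure_prodMk_left measurableSet_mem_voronoiCell

theorem measurable_pointCount_voronoiCell :
    Measurable fun q : (Config × Config) × Plane =>
      pointCount carrier (voronoiCell q.1.2.carrier q.2 \ {q.2}) q.1.1 := by
  let t : Set (((Config × Config) × Plane) × Plane) :=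
    {r | r.2 ∈ voronoiCell r.1.1.2.carrier r.1.2} ∩ {r | r.2 = r.1.2}ᶜ
  have ht : MeasurableSet t := by
    refine MeasurableSet.inter ?_ (measurableSet_eq_fun (by fun_prop) (by fun_prop)).compl
    exact measurableSet_mem_voronoiCell.preimage
      (f := fun r : ((Config × Config) × Plane) × Plane => ((r.1.1.2, r.1.2), r.2)) (by fun_prop)
  have h := ProbabilityTheory.Kernel.measurable_kernel_prodMk_left
    (κ := pointKernel.comap (fun q : (Config × Config) × Plane => q.1.1) (by fun_prop)) ht
  refine ENat.measurable_iff.2 fun k => ?_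
  convert (measurableSet_singleton (k : ℝ≥0∞)).preimage h using 1
  ext ⟨⟨φ, ψ⟩, x⟩
  simp only [Set.mem_preimage, Set.mem_singleton_iff, ProbabilityTheory.Kernel.comap_apply]
  rw [pointKernel_apply φ (measurable_prodMk_left ht), ← ENat.toENNReal_coe, ENat.toENNReal_inj]
  rfl

end Config

/-! ### Scaling of cells and of Poisson processes -/

theorem originCellArea_eq (S : Set Plane) : originCellArea S = volume (voronoiCell S 0) := by
  unfold originCellArea voronoiCell
  congr 1
  ext y
  refine ⟨fun h z hz => h z (Set.mem_insert_of_mem _ hz), ?_⟩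
  rintro h z (rfl | hz) h0
  · exact absurd rfl h0
  · exact h z hz h0

theorem volume_preimage_add_smul (x : Plane) {c : ℝ} (hc : 0 < c) (B : Set Plane) :
    volume ((fun z : Plane => x + c • z) ⁻¹' B) = ENNReal.ofReal (c⁻¹ ^ 2) * volume B := by
  have h : (fun z : Plane => x + c • z) ⁻¹' B = (c • ·) ⁻¹' ((x + ·) ⁻¹' B) := rfl
  rw [h, Measure.addHaar_preimage_smul _ hc.ne', measure_preimage_add, finrank_euclideanSpace_fin,
    abs_of_pos (by positivity), inv_pow]

theorem volume_voronoiCell_image_add_smul (S : Set Plane) (x : Plane) {c : ℝ} (hc : 0 < c) :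
    volume (voronoiCell ((fun z : Plane => x + c • z) '' S) x)
      = ENNReal.ofReal (c ^ 2) * volume (voronoiCell S 0) := by
  have h : voronoiCell S 0
      = (fun z : Plane => x + c • z) ⁻¹' voronoiCell ((fun z : Plane => x + c • z) '' S) x := by
    ext y
    simp only [voronoiCell, Set.mem_ofPred_eq, Set.mem_preimage, Set.forall_mem_image]
    refine forall₂_congr fun z _ => ?_
    have h1 : x + c • z ≠ x ↔ z ≠ 0 := by simp [hc.ne']
    have h2 : dist (x + c • y) x = c * dist y 0 := by
      simp [dist_eq_norm, norm_smul, abs_of_pos hc]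
    have h3 : dist (x + c • y) (x + c • z) = c * dist y z := by
      rw [dist_add_left, dist_smul₀, Real.norm_of_nonneg hc.le]
    rw [h1, h2, h3, mul_lt_mul_iff_right₀ hc]
  rw [h, volume_preimage_add_smul x hc, ← mul_assoc, ← ENNReal.ofReal_mul (by positivity),
    ← mul_pow, mul_inv_cancel₀ hc.ne']
  simp

theorem pointCount_image {Ω : Type*} (X : Ω → Set Plane) {f : Plane → Plane}
    (hf : Function.Injective f) (B : Set Plane) :
    pointCount (fun ω => f '' X ω) B = pointCount X (f ⁻¹' B) := by
  funext ω
  rw [pointCount, ← Set.image_inter_preimage, hf.encard_image]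
  rfl

theorem IsPoissonProcess.image_add_smul {Ω : Type*} [MeasurableSpace Ω] {μ : Measure Ω}
    {X : Ω → Set Plane} {lam : ℝ≥0} (hX : IsPoissonProcess μ X lam) (x : Plane) {c : ℝ≥0}
    (hc : 0 < c) :
    IsPoissonProcess μ (fun ω => (fun z : Plane => x + (c : ℝ) • z) '' X ω) (lam * c⁻¹ ^ 2) := by
  have hc' : (0 : ℝ) < c := hc
  have hinj : Function.Injective fun z : Plane => x + (c : ℝ) • z := fun y z h => by
    simpa [hc.ne'] using h
  have hmeas : Measurable fun z : Plane => x + (c : ℝ) • z := by fun_prop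
  have hvol (B : Set Plane) : volume ((fun z : Plane => x + (c : ℝ) • z) ⁻¹' B)
      = ((c⁻¹ ^ 2 : ℝ≥0) : ℝ≥0∞) * volume B := by
    rw [volume_preimage_add_smul x hc', ← ENNReal.ofReal_coe_nnreal]
    simp
  constructor
  · intro ω B hB
    rw [← Set.image_inter_preimage]
    refine (hX.locallyFinite ω _ ?_).image _
    obtain ⟨R, hR⟩ := hB.subset_closedBall x
    refine (Metric.isBounded_closedBall (x := (0 : Plane)) (r := R / c)).subset fun z hz => ?_
    have h := hR hz
    rw [mem_closedBall_iff_norm, add_sub_cancel_left, norm_smul, Real.norm_of_nonneg hc'.le] at h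
    rw [mem_closedBall_zero_iff, le_div_iff₀ hc', mul_comm]
    exact h
  · intro B hB
    rw [pointCount_image X hinj]
    exact hX.measurable_count _ (hmeas hB)
  · intro B hB hv k
    rw [pointCount_image X hinj, hX.count_law _ (hmeas hB)
      (by rw [hvol]; exact ENNReal.mul_ne_top ENNReal.coe_ne_top hv), hvol, ENNReal.toNNReal_mul,
      ENNReal.toNNReal_coe, mul_assoc]
  · intro n B hB hd
    simp_rw [pointCount_image X hinj]
    exact hX.count_indep n _ (fun i => hmeas (hB i)) fun i j hij => (hd hij).preimage _

/-! ### Entering edges as points of a Voronoi cell -/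

theorem pos_of_strictAntiOn_of_tendsto_zero {f : ℝ → ℝ} (hf : StrictAntiOn f (Set.Ioi 0))
    (hlim : Tendsto f atTop (𝓝 0)) {r : ℝ} (hr : 0 < r) : 0 < f r := by
  have h1 : f (r + 1) < f r := hf hr (by simp; linarith) (by linarith)
  refine lt_of_le_of_lt (le_of_tendsto hlim ?_) h1
  filter_upwards [eventually_gt_atTop (r + 1)] with s hs
  exact (hf (by simp; linarith) (by simp; linarith) hs).le

section Graph

variable {P noise : ℝ} {g : ℝ → ℝ → ℝ} {L E : Set Plane}

/-- The strongest eavesdropper for `u` is the nearest one, and the rate is positive iff `x` is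
nearer still. Disjointness keeps every distance to an eavesdropper positive, where the gain is known
to be monotone. -/
theorem iSGraph_adj_iff (hP : 0 < P) (hnoise : 0 < noise)
    (hg_anti : StrictAntiOn (fun r => g r 1) (Set.Ioi 0))
    (hg_lim : Tendsto (fun r => g r 1) atTop (𝓝 0)) (hdisj : Disjoint L E) (hne : E.Nonempty)
    (hE : ∀ B, Bornology.IsBounded B → (E ∩ B).Finite) (u x : L) :
    (iSGraph P g (fun _ _ => 1) noise noise 0 L E).Adj u x
      ↔ (u : Plane) ∈ voronoiCell E x \ {(x : Plane)} := by
  have hEu : ∀ z ∈ E, 0 < dist (u : Plane) z := fun z hz =>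
    dist_pos.2 fun h => Set.disjoint_left.1 hdisj u.2 (h ▸ hz)
  have hEx : ∀ z ∈ E, z ≠ x := fun z hz h => Set.disjoint_left.1 hdisj x.2 (h ▸ hz)
  have hle {r s : ℝ} (hr : 0 < r) (hs : 0 < s) : P * g r 1 ≤ P * g s 1 ↔ s ≤ r := by
    rw [mul_le_mul_iff_right₀ hP]
    exact hg_anti.le_iff_ge hr hs
  have hmax {e : Plane} (he : e ∈ E) :
      IsMaxOn (rxPower P g (fun _ _ => 1) (u : Plane)) E e ↔ ∀ z ∈ E, dist (u : Plane) e ≤ dist (u : Plane) z := by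
    rw [isMaxOn_iff]
    exact forall₂_congr fun z hz => hle (hEu z hz) (hEu e he)
  have hrate {e : Plane} (he : e ∈ E) (hux : 0 < dist (u : Plane) x) :
      0 < secrecyRate P g (fun _ _ => 1) noise noise u x e ↔ dist (u : Plane) x < dist (u : Plane) e := by
    have hpos {r : ℝ} (hr : 0 < r) : 0 < 1 + P * g r 1 / noise := by
      have := pos_of_strictAntiOn_of_tendsto_zero hg_anti hg_lim hr
      positivity
    rw [secrecyRate, lt_max_iff, or_iff_left (lt_irrefl 0), sub_pos, rxPower, rxPower,
      Real.logb_lt_logb_iff one_lt_two (hpos (hEu e he)) (hpos hux), add_lt_add_iff_left,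
      div_lt_div_iff_of_pos_right hnoise, ← not_le, hle hux (hEu e he), not_le]
  change ((u ≠ x) ∧ ∃ e ∈ E, _) ↔ _
  have hux : u ≠ x ↔ (u : Plane) ∉ ({(x : Plane)} : Set Plane) := by
    simp [Subtype.ext_iff]
  rw [hux, Set.mem_sdiff, and_comm]
  refine and_congr_left fun h => ?_
  have hd : 0 < dist (u : Plane) x := dist_pos.2 h
  constructor
  · rintro ⟨e, he, hm, hr⟩ z hz -
    exact ((hrate he hd).1 hr).trans_le ((hmax he).1 hm z hz)
  · intro hc
    obtain ⟨z₀, hz₀⟩ := hne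
    -- A nearest eavesdropper exists: only the finitely many in the closed ball about `u` reaching
    -- `z₀` compete.
    obtain ⟨e, ⟨he, heb⟩, hmin⟩ := Set.exists_min_image _ (fun z => dist (u : Plane) z)
      (hE (Metric.closedBall u (dist (u : Plane) z₀)) Metric.isBounded_closedBall)
      ⟨z₀, hz₀, by simp [dist_comm]⟩
    refine ⟨e, he, (hmax he).2 fun z hz => ?_, (hrate he hd).2 (hc e he (hEx e he))⟩
    by_cases hzb : dist (u : Plane) z ≤ dist (u : Plane) z₀
    · exact hmin z ⟨hz, by simpa [dist_comm] using hzb⟩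
    · rw [Metric.mem_closedBall, dist_comm] at heb
      linarith

theorem inDegree_iSGraph (hP : 0 < P) (hnoise : 0 < noise)
    (hg_anti : StrictAntiOn (fun r => g r 1) (Set.Ioi 0))
    (hg_lim : Tendsto (fun r => g r 1) atTop (𝓝 0)) (hdisj : Disjoint L E) (hne : E.Nonempty)
    (hE : ∀ B, Bornology.IsBounded B → (E ∩ B).Finite) (x : L) :
    inDegree (iSGraph P g (fun _ _ => 1) noise noise 0 L E) x
      = (L ∩ (voronoiCell E x \ {(x : Plane)})).encard := by
  rw [inDegree, ← Subtype.val_injective.encard_image]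
  congr 1
  ext u
  simp only [iSGraph_adj_iff hP hnoise hg_anti hg_lim hdisj hne hE]
  simp
  tauto

end Graph

/-! ### Generating function and moments of the Poisson distribution -/

theorem lintegral_exp_poissonENat (m : ℝ≥0) (s : ℝ) :
    ∫⁻ n, EReal.exp ((s : EReal) * ((n : ℝ≥0∞) : EReal)) ∂poissonENat m
      = ENNReal.ofReal (Real.exp (m * (Real.exp s - 1))) := by
  have hs : HasSum (fun k : ℕ => Real.exp (-m) * ((Real.exp s * m) ^ k / k.factorial))
      (Real.exp (-m) * Real.exp (Real.exp s * m)) := by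
    refine HasSum.mul_left _ ?_
    rw [Real.exp_eq_exp_ℝ]
    exact NormedSpace.expSeries_div_hasSum_exp _
  have h1 : Real.exp (m * (Real.exp s - 1)) = Real.exp (-m) * Real.exp (Real.exp s * m) := by
    rw [← Real.exp_add]; ring_nf
  rw [lintegral_poissonENat, h1, ← hs.tsum_eq,
    ENNReal.ofReal_tsum_of_nonneg (fun k => by positivity) hs.summable]
  refine tsum_congr fun k => ?_
  have h2 : (s : EReal) * (((k : ℕ∞) : ℝ≥0∞) : EReal) = ((s * k : ℝ) : EReal) := by
    rw [ENat.toENNReal_coe, ← ENNReal.coe_natCast, EReal.coe_nnreal_eq_coe_real, EReal.coe_mul]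
    simp
  rw [h2, EReal.exp_coe, ← ENNReal.ofReal_mul (Real.exp_pos _).le]
  congr 1
  rw [mul_comm s, Real.exp_nat_mul, mul_pow]
  ring

theorem Nat.pow_eq_sum_stirlingSecond_mul_descFactorial (n p : ℕ) :
    n ^ p = ∑ k ∈ Finset.range (p + 1), Nat.stirlingSecond p k * n.descFactorial k := by
  induction p with
  | zero => simp
  | succ p ih =>
    have hstep (k : ℕ) : n * n.descFactorial k = n.descFactorial (k + 1) + k * n.descFactorial k := by
      rw [Nat.descFactorial_succ]
      rcases le_or_gt k n with h | h
      · rw [← add_mul, Nat.sub_add_cancel h]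
      · simp [Nat.descFactorial_eq_zero_iff_lt.2 h]
    rw [Finset.sum_range_succ']
    simp only [Nat.stirlingSecond_succ_succ, Nat.stirlingSecond_succ_zero, zero_mul, add_zero,
      add_mul _ _ (Nat.descFactorial _ _), Finset.sum_add_distrib]
    -- The index shift is exact: the new last term has `stirlingSecond p (p + 1) = 0`, and the `k =
    -- 0` term carries the factor `k`.
    have h1 : ∑ k ∈ Finset.range (p + 1),
          (k + 1) * Nat.stirlingSecond p (k + 1) * n.descFactorial (k + 1)
        = ∑ k ∈ Finset.range (p + 1), k * Nat.stirlingSecond p k * n.descFactorial k := by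
      rw [Finset.sum_range_succ, Finset.sum_range_succ',
        Nat.stirlingSecond_eq_zero_of_lt (Nat.lt_succ_self p)]
      simp
    rw [pow_succ, ih, Finset.sum_mul, h1, ← Finset.sum_add_distrib]
    refine Finset.sum_congr rfl fun k _ => ?_
    rw [mul_assoc, mul_comm _ n, hstep]
    ring

theorem lintegral_descFactorial_poissonENat (m : ℝ≥0) (k : ℕ) :
    ∫⁻ n, ((n.toNat.descFactorial k : ℕ) : ℝ≥0∞) ∂poissonENat m = (m : ℝ≥0∞) ^ k := by
  induction k with
  | zero => simp
  | succ k ih =>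
    -- After multiplication by `n` this function is the falling factorial of order `k + 1`; after
    -- the shift it is that of order `k`. The value of `toNat` at `⊤` is harmless, as `⊤` has no
    -- mass.
    have h := lintegral_mul_poissonENat m fun n => (((n.toNat - 1).descFactorial k : ℕ) : ℝ≥0∞)
    have hl : ∫⁻ n, (n : ℝ≥0∞) * (((n.toNat - 1).descFactorial k : ℕ) : ℝ≥0∞) ∂poissonENat m
        = ∫⁻ n, ((n.toNat.descFactorial (k + 1) : ℕ) : ℝ≥0∞) ∂poissonENat m := by
      rw [lintegral_poissonENat, lintegral_poissonENat]
      refine tsum_congr fun n => ?_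
      congr 1
      cases n with
      | zero => simp
      | succ n =>
        rw [ENat.toNat_natCast, Nat.succ_descFactorial_succ, ENat.toENNReal_coe]
        simp
    have hr : ∫⁻ n : ℕ∞, ((((n + 1).toNat - 1).descFactorial k : ℕ) : ℝ≥0∞) ∂poissonENat m
        = ∫⁻ n, ((n.toNat.descFactorial k : ℕ) : ℝ≥0∞) ∂poissonENat m := by
      rw [lintegral_poissonENat, lintegral_poissonENat]
      refine tsum_congr fun n => ?_
      rw [← Nat.cast_one, ← Nat.cast_add, ENat.toNat_natCast, ENat.toNat_natCast,
        Nat.add_sub_cancel]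
    rw [pow_succ', ← ih, ← hl, ← hr]
    exact h

theorem lintegral_pow_poissonENat (m : ℝ≥0) {p : ℕ} (hp : 1 ≤ p) :
    ∫⁻ n, (n : ℝ≥0∞) ^ p ∂poissonENat m
      = ∑ k ∈ Finset.Icc 1 p, (Nat.stirlingSecond p k : ℝ≥0∞) * (m : ℝ≥0∞) ^ k := by
  have h1 : ∫⁻ n, (n : ℝ≥0∞) ^ p ∂poissonENat m = ∫⁻ n, ∑ k ∈ Finset.range (p + 1),
      (Nat.stirlingSecond p k : ℝ≥0∞) * ((n.toNat.descFactorial k : ℕ) : ℝ≥0∞) ∂poissonENat m := by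
    rw [lintegral_poissonENat, lintegral_poissonENat]
    refine tsum_congr fun n => ?_
    congr 1
    rw [ENat.toNat_natCast, ENat.toENNReal_coe]
    exact_mod_cast congrArg (Nat.cast (R := ℝ≥0∞))
      (Nat.pow_eq_sum_stirlingSecond_mul_descFactorial n p)
  rw [h1, lintegral_finsetSum _ fun k _ => .of_discrete]
  simp_rw [lintegral_const_mul _ (Measurable.of_discrete), lintegral_descFactorial_poissonENat]
  rw [Finset.range_eq_Ico, Finset.sum_eq_sum_Ico_succ_bot (by omega)]
  obtain ⟨p, rfl⟩ := Nat.exists_eq_succ_of_ne_zero (by omega : p ≠ 0)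
  simp only [Nat.succ_eq_add_one, Nat.stirlingSecond_succ_zero, Nat.cast_zero, zero_mul, zero_add]
  rfl

/-! ### Finiteness of the moments of the cell area -/

section CellMoments

theorem lintegral_gaussian_ne_top {b : ℝ} (hb : 0 < b) :
    ∫⁻ y : Plane, ENNReal.ofReal (Real.exp (-b * ‖y‖ ^ 2)) ≠ ∞ := by
  have h1 := GaussianFourier.integral_rexp_neg_mul_sq_norm (V := Plane) hb
  have h2 : Integrable fun y : Plane => Real.exp (-b * ‖y‖ ^ 2) := by
    -- A non-integrable function would have Bochner integral `0`, while the Gaussian integral is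
    -- positive.
    by_contra h
    rw [integral_undef h] at h1
    have : (0 : ℝ) < (Real.pi / b) ^ (Module.finrank ℝ Plane / 2 : ℝ) := by positivity
    exact this.ne h1
  exact h2.lintegral_lt_top.ne

/-- Hölder's inequality against a Gaussian weight. -/
theorem volume_pow_le (V : Set Plane) (k : ℕ) (a : ℝ) :
    volume V ^ (k + 1) ≤ (∫⁻ y in V, ENNReal.ofReal (Real.exp (k * a * ‖y‖ ^ 2)))
      * (∫⁻ y : Plane, ENNReal.ofReal (Real.exp (-a * ‖y‖ ^ 2))) ^ k := by
  have hk : (0 : ℝ) < k + 1 := by positivity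
  have h := ENNReal.lintegral_mul_norm_pow_le (μ := volume.restrict V)
    (f := fun y : Plane => ENNReal.ofReal (Real.exp (k * a * ‖y‖ ^ 2)))
    (g := fun y : Plane => ENNReal.ofReal (Real.exp (-a * ‖y‖ ^ 2))) (by fun_prop) (by fun_prop)
    (p := 1 / (k + 1)) (q := k / (k + 1)) (by positivity) (by positivity) (by field_simp; ring)
  -- The two weights cancel under the Hölder exponents, so the left side of Hölder is just the area
  -- of `V`.
  have h1 (y : Plane) : ENNReal.ofReal (Real.exp (k * a * ‖y‖ ^ 2)) ^ (1 / (k + 1) : ℝ)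
      * ENNReal.ofReal (Real.exp (-a * ‖y‖ ^ 2)) ^ (k / (k + 1) : ℝ) = 1 := by
    rw [ENNReal.ofReal_rpow_of_pos (Real.exp_pos _), ENNReal.ofReal_rpow_of_pos (Real.exp_pos _),
      ← ENNReal.ofReal_mul (by positivity), ← Real.exp_mul, ← Real.exp_mul, ← Real.exp_add]
    have : k * a * ‖y‖ ^ 2 * (1 / (k + 1)) + -a * ‖y‖ ^ 2 * (k / (k + 1)) = 0 := by ring
    rw [this]; simp
  simp_rw [h1] at h
  rw [lintegral_one, Measure.restrict_apply_univ] at h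
  have h2 := pow_le_pow_left₀ zero_le h (k + 1)
  rw [mul_pow, ← ENNReal.rpow_mul_natCast, ← ENNReal.rpow_mul_natCast] at h2
  have e1 : (1 / (k + 1) : ℝ) * ((k + 1 : ℕ) : ℝ) = 1 := by push_cast; field_simp
  have e2 : (k / (k + 1) : ℝ) * ((k + 1 : ℕ) : ℝ) = k := by push_cast; field_simp
  rw [e1, e2, ENNReal.rpow_one, ENNReal.rpow_natCast] at h2
  refine h2.trans ?_
  gcongr
  exact Measure.restrict_le_self

variable {Ω : Type*} [MeasurableSpace Ω] {ν : Measure Ω}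
  {T : Ω → Set Plane} {lam : ℝ≥0}

/-- The event says that the closed disc about `y` through the origin, punctured there, is empty;
this is a void probability. -/
theorem IsPoissonProcess.measure_mem_voronoiCell_zero (hT : IsPoissonProcess ν T lam) (y : Plane) :
    ν {ω | y ∈ voronoiCell (T ω) 0}
      = ENNReal.ofReal (Real.exp (-(lam * volume.real (Metric.ball (0 : Plane) 1)) * ‖y‖ ^ 2)) := by
  let B : Set Plane := Metric.closedBall y ‖y‖ \ {0}
  have hB : MeasurableSet B := measurableSet_closedBall.diff (measurableSet_singleton 0)
  have hvol : volume B = volume (Metric.closedBall y ‖y‖) :=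
    measure_sdiff_null (by simp)
  have h1 : {ω | y ∈ voronoiCell (T ω) 0} = {ω | pointCount T B ω = (0 : ℕ)} := by
    ext ω
    simp only [Set.mem_ofPred_eq, voronoiCell, pointCount, Nat.cast_zero, Set.encard_eq_zero,
      Set.eq_empty_iff_forall_notMem, B, dist_zero_right]
    refine forall_congr' fun z => ?_
    simp only [Set.mem_inter_iff, Set.mem_sdiff, Metric.mem_closedBall, Set.mem_singleton_iff,
      dist_comm z y, ← not_lt]
    tauto
  rw [h1, hT.count_law B hB (hvol ▸ measure_closedBall_lt_top.ne) 0,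
    ProbabilityTheory.poissonMeasure_singleton, hvol]
  have h2 := Measure.addHaar_real_closedBall (volume : Measure Plane) y (norm_nonneg y)
  rw [finrank_euclideanSpace_fin] at h2
  simp only [NNReal.coe_mul, pow_zero, Nat.factorial_zero, Nat.cast_one, mul_one, div_one]
  change ENNReal.ofReal (Real.exp (-(lam * volume.real (Metric.closedBall y ‖y‖)))) = _
  rw [h2]
  congr 2
  ring

theorem IsPoissonProcess.lintegral_originCellArea_pow_ne_top
    [IsProbabilityMeasure ν] (hT : IsPoissonProcess ν T lam)
    (hlam : 0 < lam) (k : ℕ) : ∫⁻ ω, originCellArea (T ω) ^ k ∂ν ≠ ∞ := by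
  cases k with
  | zero => simp
  | succ k =>
  set b : ℝ := lam * volume.real (Metric.ball (0 : Plane) 1) with hb
  have hb0 : 0 < b := mul_pos hlam (ENNReal.toReal_pos
    (Metric.measure_ball_pos _ _ one_pos).ne' measure_ball_lt_top.ne)
  -- This choice gives `k * a - b = -a`: the weight times the probability of lying in the cell is
  -- again the Gaussian integrated in `C`, and the moment is at most `C ^ (k + 1)`.
  set a : ℝ := b / (k + 1) with ha
  have ha0 : 0 < a := by positivity
  let f : Plane → ℝ≥0∞ := fun y => ENNReal.ofReal (Real.exp (k * a * ‖y‖ ^ 2))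
  have hf : Measurable f := by fun_prop
  have hS : MeasurableSet {q : Ω × Plane | q.2 ∈ voronoiCell (T q.1) 0} :=
    Config.measurableSet_mem_voronoiCell.preimage
      (f := fun q : Ω × Plane => ((hT.toConfig q.1, (0 : Plane)), q.2))
      (((hT.measurable_toConfig.comp measurable_fst).prodMk measurable_const).prodMk measurable_snd)
  have hcell (ω : Ω) : MeasurableSet (voronoiCell (T ω) 0) := measurable_prodMk_left hS
  have hF : Measurable (Function.uncurry fun (ω : Ω) (y : Plane) =>
      (voronoiCell (T ω) 0).indicator f y) :=
    (hf.comp measurable_snd).indicator hS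
  set C := (∫⁻ y : Plane, ENNReal.ofReal (Real.exp (-a * ‖y‖ ^ 2))) with hC
  have hC0 : C ≠ ∞ := lintegral_gaussian_ne_top ha0
  have hbound : ∫⁻ ω, originCellArea (T ω) ^ (k + 1) ∂ν
      ≤ ∫⁻ ω, (∫⁻ y, (voronoiCell (T ω) 0).indicator f y) * C ^ k ∂ν := by
    refine lintegral_mono fun ω => ?_
    rw [originCellArea_eq, lintegral_indicator (hcell ω)]
    exact volume_pow_le _ k a
  have heq : ∫⁻ ω, (∫⁻ y, (voronoiCell (T ω) 0).indicator f y) ∂ν = C := by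
    rw [lintegral_lintegral_swap hF.aemeasurable]
    refine lintegral_congr fun y => ?_
    have h1 (ω : Ω) : (voronoiCell (T ω) 0).indicator f y
        = {ω | y ∈ voronoiCell (T ω) 0}.indicator (fun _ => f y) ω := rfl
    have hy : MeasurableSet {ω | y ∈ voronoiCell (T ω) 0} := measurable_prodMk_right hS
    simp_rw [h1]
    rw [lintegral_indicator_const hy, hT.measure_mem_voronoiCell_zero,
      ← ENNReal.ofReal_mul (Real.exp_pos _).le, ← Real.exp_add]
    congr 2
    rw [← hb, ha]
    field_simp
    ring
  rw [lintegral_mul_const _ hF.lintegral_prod_right, heq] at hbound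
  exact ne_top_of_le_ne_top (ENNReal.mul_ne_top hC0 (ENNReal.pow_ne_top hC0)) hbound

end CellMoments

/-! ### The in-degree of a typical node as a mixed Poisson variable -/

section Palm

open Config

variable {Ω : Type*} [MeasurableSpace Ω] {μ : Measure Ω} [IsProbabilityMeasure μ]
  {Ω' : Type*} [MeasurableSpace Ω'] {ν : Measure Ω'}
  {lamL lamE : ℝ≥0} {L E : Ω → Set Plane} {T : Ω' → Set Plane}

instance IsPoissonProcess.isProbabilityMeasure_law {X : Ω → Set Plane} {lam : ℝ≥0}
    (hX : IsPoissonProcess μ X lam) : IsProbabilityMeasure hX.law :=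
  Measure.isProbabilityMeasure_map hX.measurable_toConfig.aemeasurable

theorem IsPoissonProcess.measurable_originCellArea (hT : IsPoissonProcess ν T 1) :
    Measurable fun ω => originCellArea (T ω) := by
  simp_rw [originCellArea_eq]
  exact measurable_volume_voronoiCell.comp (hT.measurable_toConfig.prodMk measurable_const)

variable [IsProbabilityMeasure ν]

theorem IsPoissonProcess.ae_originCellArea_lt_top (hT : IsPoissonProcess ν T 1) :
    ∀ᵐ ω ∂ν, originCellArea (T ω) < ∞ := by
  refine ae_lt_top hT.measurable_originCellArea ?_
  simpa using hT.lintegral_originCellArea_pow_ne_top one_pos 1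

/-- The cell areas of a Poisson process are those of a scaled unit-density process. -/
theorem IsPoissonProcess.map_volume_voronoiCell (hE : IsPoissonProcess μ E lamE)
    (hlamE : 0 < lamE) (hT : IsPoissonProcess ν T 1) (x : Plane) :
    hE.law.map (fun ψ => volume (voronoiCell ψ.carrier x))
      = ν.map (fun ω => (lamE : ℝ≥0∞)⁻¹ * originCellArea (T ω)) := by
  -- Dilating a unit-density process by `lamE ^ (-1/2)` gives density `lamE` and multiplies areas by
  -- `lamE⁻¹`.
  have hc : 0 < NNReal.sqrt lamE⁻¹ := NNReal.sqrt_pos.2 (inv_pos.2 hlamE)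
  have hX := hT.image_add_smul x hc
  have hlam : 1 * (NNReal.sqrt lamE⁻¹)⁻¹ ^ 2 = lamE := by
    rw [one_mul, inv_pow, NNReal.sq_sqrt, inv_inv]
  rw [hlam] at hX
  have hm : Measurable fun ψ : Config => volume (voronoiCell ψ.carrier x) :=
    measurable_volume_voronoiCell.comp (measurable_id.prodMk measurable_const)
  rw [hE.isPoissonProcess_law.measure_eq hX.isPoissonProcess_law, law,
    Measure.map_map hm hX.measurable_toConfig]
  congr 1
  funext ω
  have hsq : ENNReal.ofReal ((NNReal.sqrt lamE⁻¹ : ℝ) ^ 2) = (lamE : ℝ≥0∞)⁻¹ := by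
    rw [ENNReal.ofReal_pow (NNReal.coe_nonneg _), ENNReal.ofReal_coe_nnreal, ← ENNReal.coe_pow,
      NNReal.sq_sqrt, ENNReal.coe_inv hlamE.ne']
  rw [originCellArea_eq, ← hsq]
  exact volume_voronoiCell_image_add_smul (T ω) x (NNReal.coe_pos.2 hc)

theorem measurable_lintegral_poissonENat (lam : ℝ≥0) (F : ℕ∞ → ℝ≥0∞) :
    Measurable fun v : ℝ≥0∞ => ∫⁻ n, F n ∂poissonENat (lam * v.toNNReal) := by
  simp_rw [lintegral_poissonENat]
  refine Measurable.tsum fun k => ?_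
  fun_prop

theorem measurableSet_disjoint :
    MeasurableSet {p : Config × Config | Disjoint p.1.carrier p.2.carrier} := by
  let t : Set ((Config × Config) × Plane) := {q | q.2 ∈ q.1.2.carrier}
  have ht : MeasurableSet t := measurableSet_mem_carrier.preimage
    (f := fun q : (Config × Config) × Plane => (q.1.2, q.2)) (by fun_prop)
  have h := ProbabilityTheory.Kernel.measurable_kernel_prodMk_left
    (κ := pointKernel.comap (fun q : Config × Config => q.1) measurable_fst) ht
  convert (measurableSet_singleton (0 : ℝ≥0∞)).preimage h using 1
  ext ⟨φ, ψ⟩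
  simp only [Set.mem_preimage, Set.mem_singleton_iff, ProbabilityTheory.Kernel.comap_apply]
  rw [pointKernel_apply φ (measurable_prodMk_left ht), ENat.toENNReal_eq_zero,
    Set.encard_eq_zero, ← Set.disjoint_iff_inter_eq_empty]
  rfl

theorem IsPoissonProcess.map_prodMk (hL : IsPoissonProcess μ L lamL)
    (hE : IsPoissonProcess μ E lamE)
    (hLE : ProbabilityTheory.Indep (pointSigma L) (pointSigma E) μ) :
    μ.map (fun ω => (hL.toConfig ω, hE.toConfig ω)) = hL.law.prod hE.law := by
  refine ProbabilityTheory.IndepFun.map_prod_eq_prod_map_map hL.measurable_toConfig.aemeasurable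
    hE.measurable_toConfig.aemeasurable ?_
  rw [ProbabilityTheory.IndepFun_iff_Indep, comap_toConfig, comap_toConfig]
  exact hLE

/-- Given `L`, its points form a countable null set, which an independent Poisson process almost
surely avoids. -/
theorem IsPoissonProcess.ae_disjoint (hL : IsPoissonProcess μ L lamL)
    (hE : IsPoissonProcess μ E lamE)
    (hLE : ProbabilityTheory.Indep (pointSigma L) (pointSigma E) μ) :
    ∀ᵐ ω ∂μ, Disjoint (L ω) (E ω) := by
  have h : ∀ᵐ p ∂hL.law.prod hE.law, p ∈ {p : Config × Config | Disjoint p.1.carrier p.2.carrier} := by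
    rw [Measure.ae_prod_mem_iff_ae_ae_mem measurableSet_disjoint]
    refine Eventually.of_forall fun φ => ?_
    filter_upwards [hE.isPoissonProcess_law.ae_pointCount_eq_zero φ.countable.measurableSet
      (φ.countable.measure_zero _)] with ψ hψ
    rw [pointCount, Set.encard_eq_zero, ← Set.disjoint_iff_inter_eq_empty] at hψ
    exact hψ.symm
  rw [← hL.map_prodMk hE hLE] at h
  exact ae_of_ae_map (hL.measurable_toConfig.prodMk hE.measurable_toConfig).aemeasurable h

theorem IsPoissonProcess.ae_volume_voronoiCell_lt_top (hE : IsPoissonProcess μ E lamE)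
    (hlamE : 0 < lamE) (hT : IsPoissonProcess ν T 1) (x : Plane) :
    ∀ᵐ ψ ∂hE.law, volume (voronoiCell ψ.carrier x) < ∞ := by
  have hm : Measurable fun ψ : Config => volume (voronoiCell ψ.carrier x) :=
    measurable_volume_voronoiCell.comp (measurable_id.prodMk measurable_const)
  rw [← ae_map_iff (p := fun v : ℝ≥0∞ => v < ∞) hm.aemeasurable measurableSet_Iio,
    hE.map_volume_voronoiCell hlamE hT x,
    ae_map_iff (hT.measurable_originCellArea.const_mul _).aemeasurable measurableSet_Iio]
  filter_upwards [hT.ae_originCellArea_lt_top] with ω hω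
  exact ENNReal.mul_lt_top (ENNReal.inv_lt_top.2 (by simpa using hlamE)) hω

/-- Without eavesdroppers the cell of the origin would be the whole plane, of infinite area. This
excludes the case where no maximizing `e` exists and the graph has no edges. -/
theorem IsPoissonProcess.ae_nonempty (hE : IsPoissonProcess μ E lamE)
    (hlamE : 0 < lamE) (hT : IsPoissonProcess ν T 1) : ∀ᵐ ω ∂μ, (E ω).Nonempty := by
  filter_upwards [ae_of_ae_map hE.measurable_toConfig.aemeasurable
    (hE.ae_volume_voronoiCell_lt_top hlamE hT 0)] with ω hω
  rw [Set.nonempty_iff_ne_empty]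
  intro h
  have h1 : (hE.toConfig ω).carrier = ∅ := h
  simp [h1, voronoiCell] at hω

/-- In a Poisson process of density `lamL`, the mean of a function of the number of points in the
Voronoi cell of a typical point, with respect to an independent Poisson process. -/
theorem lintegral_voronoiCell_count (hL : IsPoissonProcess μ L lamL)
    (hE : IsPoissonProcess μ E lamE) (hlamE : 0 < lamE) (hT : IsPoissonProcess ν T 1)
    {W : Set Plane} (hW : MeasurableSet W) (F : ℕ∞ → ℝ≥0∞) :
    ∫⁻ p, ∫⁻ x, W.indicator
        (fun x => F (pointCount carrier (voronoiCell p.2.carrier x \ {x}) p.1)) x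
        ∂pointKernel p.1 ∂(hL.law.prod hE.law)
      = lamL * volume W * ∫⁻ ω, ∫⁻ n, F n
          ∂poissonENat (lamL * ((lamE : ℝ≥0∞)⁻¹ * originCellArea (T ω)).toNNReal) ∂ν := by
  set f : (Config × Config) × Plane → ℝ≥0∞ := fun q =>
    W.indicator (fun x => F (pointCount carrier (voronoiCell q.1.2.carrier x \ {x}) q.1.1)) q.2
    with hf
  have hfm : Measurable f :=
    ((Measurable.of_discrete (f := F)).comp measurable_pointCount_voronoiCell).indicator
      (measurable_snd hW)
  set H : ℝ≥0∞ → ℝ≥0∞ := fun v => ∫⁻ n, F n ∂poissonENat (lamL * v.toNNReal) with hH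
  have hHm : Measurable H := measurable_lintegral_poissonENat lamL F
  -- The cell depends on `ψ` only and is punctured at `x`, so the point added by Mecke's formula is
  -- not counted.
  have hadd (φ ψ : Config) (x : Plane) : f ((φ.addPoint x, ψ), x) = f ((φ, ψ), x) := by
    by_cases hx : x ∈ W
    · simp only [hf, Set.indicator_of_mem hx, pointCount, addPoint]
      rw [Set.insert_inter_of_notMem fun h => h.2 rfl]
    · simp only [hf, Set.indicator_of_notMem hx]
  have hcm (x : Plane) : Measurable fun ψ : Config => volume (voronoiCell ψ.carrier x) :=
    measurable_volume_voronoiCell.comp (measurable_id.prodMk measurable_const)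
  have hmecke (ψ : Config) : ∫⁻ φ, ∫⁻ x, f ((φ, ψ), x) ∂pointKernel φ ∂hL.law
      = lamL * ∫⁻ x, ∫⁻ φ, f ((φ, ψ), x) ∂hL.law := by
    rw [hL.isPoissonProcess_law.lintegral_lintegral_pointKernel (f := fun φ x => f ((φ, ψ), x))
      (hfm.comp (by fun_prop : Measurable fun p : Config × Plane => ((p.1, ψ), p.2)))]
    simp_rw [hadd]
  -- For fixed `ψ` the count is Poisson with mean `lamL` times the cell area; almost sure finiteness
  -- makes `toNNReal` faithful. The resulting average does not depend on `x ∈ W`.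
  have hinner (x : Plane) : ∫⁻ ψ, ∫⁻ φ, f ((φ, ψ), x) ∂hL.law ∂hE.law
      = W.indicator (fun _ => ∫⁻ ω, H ((lamE : ℝ≥0∞)⁻¹ * originCellArea (T ω)) ∂ν) x := by
    by_cases hx : x ∈ W
    · rw [Set.indicator_of_mem hx, ← lintegral_map hHm (hT.measurable_originCellArea.const_mul _),
        ← hE.map_volume_voronoiCell hlamE hT x, lintegral_map hHm (hcm x)]
      refine lintegral_congr_ae ?_
      filter_upwards [hE.ae_volume_voronoiCell_lt_top hlamE hT x] with ψ hψ
      have hv : volume (voronoiCell ψ.carrier x \ {x}) = volume (voronoiCell ψ.carrier x) :=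
        measure_sdiff_null (by simp)
      simp only [hf, Set.indicator_of_mem hx]
      rw [hL.isPoissonProcess_law.lintegral_pointCount
        ((measurableSet_voronoiCell ψ x).diff (measurableSet_singleton x))
        (by rw [hv]; exact hψ.ne), hv]
    · simp [hf, Set.indicator_of_notMem hx]
  have hΦ : Measurable fun p : Config × Config => ∫⁻ x, f (p, x) ∂pointKernel p.1 :=
    hfm.lintegral_kernel_prod_right' (κ := pointKernel.comap Prod.fst measurable_fst)
  have hA : Measurable (Function.uncurry fun (ψ : Config) (x : Plane) =>
      ∫⁻ φ, f ((φ, ψ), x) ∂hL.law) :=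
    (hfm.comp (by fun_prop : Measurable fun q : Config × (Config × Plane) =>
      ((q.1, q.2.1), q.2.2))).lintegral_prod_left'
  calc _ = ∫⁻ p, ∫⁻ x, f (p, x) ∂pointKernel p.1 ∂(hL.law.prod hE.law) := rfl
    _ = ∫⁻ ψ, ∫⁻ φ, ∫⁻ x, f ((φ, ψ), x) ∂pointKernel φ ∂hL.law ∂hE.law :=
      lintegral_prod_symm' _ hΦ
    _ = lamL * ∫⁻ ψ, ∫⁻ x, ∫⁻ φ, f ((φ, ψ), x) ∂hL.law ∂volume ∂hE.law := by
      simp_rw [hmecke]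
      exact lintegral_const_mul _ hA.lintegral_prod_right
    _ = lamL * ∫⁻ x, ∫⁻ ψ, ∫⁻ φ, f ((φ, ψ), x) ∂hL.law ∂hE.law := by
      rw [lintegral_lintegral_swap hA.aemeasurable]
    _ = _ := by
      simp_rw [hinner]
      rw [lintegral_indicator_const hW, mul_assoc, mul_comm (volume W)]

theorem palmMean_inDegree (hlamL : 0 < lamL) (hlamE : 0 < lamE)
    (hL : IsPoissonProcess μ L lamL) (hE : IsPoissonProcess μ E lamE)
    (hLE : ProbabilityTheory.Indep (pointSigma L) (pointSigma E) μ)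
    (hT : IsPoissonProcess ν T 1)
    {P noise : ℝ} (hP : 0 < P) (hnoise : 0 < noise) {g : ℝ → ℝ → ℝ}
    (hg_anti : StrictAntiOn (fun r => g r 1) (Set.Ioi 0))
    (hg_lim : Tendsto (fun r => g r 1) atTop (𝓝 0))
    {W : Set Plane} (hW : MeasurableSet W) (hW_pos : volume W ≠ 0) (hW_fin : volume W ≠ ∞)
    (F : ℕ∞ → ℝ≥0∞) :
    palmMean μ L lamL W (fun ω x =>
        F (inDegree (iSGraph P g (fun _ _ => 1) noise noise 0 (L ω) (E ω)) x))
      = ∫⁻ ω, ∫⁻ n, F n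
          ∂poissonENat (lamL * ((lamE : ℝ≥0∞)⁻¹ * originCellArea (T ω)).toNNReal) ∂ν := by
  have hl : (lamL : ℝ≥0∞) ≠ 0 := by simpa using hlamL.ne'
  have hfm : Measurable fun q : (Config × Config) × Plane => W.indicator
      (fun x => F (pointCount carrier (voronoiCell q.1.2.carrier x \ {x}) q.1.1)) q.2 :=
    ((Measurable.of_discrete (f := F)).comp measurable_pointCount_voronoiCell).indicator
      (measurable_snd hW)
  have hΦ : Measurable fun p : Config × Config => ∫⁻ x, W.indicator
      (fun x => F (pointCount carrier (voronoiCell p.2.carrier x \ {x}) p.1)) x ∂pointKernel p.1 :=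
    hfm.lintegral_kernel_prod_right' (κ := pointKernel.comap Prod.fst measurable_fst)
  have h1 : ∫⁻ ω, ∑' x : L ω, W.indicator (fun _ =>
        F (inDegree (iSGraph P g (fun _ _ => 1) noise noise 0 (L ω) (E ω)) x)) (x : Plane) ∂μ
      = ∫⁻ p, ∫⁻ x, W.indicator
          (fun x => F (pointCount carrier (voronoiCell p.2.carrier x \ {x}) p.1)) x
          ∂pointKernel p.1 ∂(hL.law.prod hE.law) := by
    rw [← hL.map_prodMk hE hLE, lintegral_map hΦ
      (hL.measurable_toConfig.prodMk hE.measurable_toConfig)]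
    refine lintegral_congr_ae ?_
    -- The geometric description of the in-degree holds off the null event that `L` meets `E` or `E`
    -- is empty.
    filter_upwards [hL.ae_disjoint hE hLE, hE.ae_nonempty hlamE hT] with ω hd hne
    rw [lintegral_pointKernel]
    refine tsum_congr fun x => ?_
    by_cases hx : (x : Plane) ∈ W
    · rw [Set.indicator_of_mem hx, Set.indicator_of_mem hx,
        inDegree_iSGraph hP hnoise hg_anti hg_lim hd hne (hE.locallyFinite ω)]
      rfl
    · rw [Set.indicator_of_notMem hx, Set.indicator_of_notMem hx]
  rw [palmMean, h1, lintegral_voronoiCell_count hL hE hlamE hT hW F, mul_comm,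
    ENNReal.mul_div_cancel_right (mul_ne_zero hl hW_pos) (ENNReal.mul_ne_top ENNReal.coe_ne_top hW_fin)]

end Palm

theorem mainTheorem1
    {Ω : Type*} [MeasurableSpace Ω] (μ : Measure Ω) [IsProbabilityMeasure μ]
    {Ω' : Type*} [MeasurableSpace Ω'] (ν : Measure Ω') [IsProbabilityMeasure ν]
    (lamL lamE : ℝ≥0) (hlamL : 0 < lamL) (hlamE : 0 < lamE)
    -- the legitimate nodes and the eavesdroppers
    (L E : Ω → Set Plane)
    (hL : IsPoissonProcess μ L lamL) (hE : IsPoissonProcess μ E lamE)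
    (hLE : ProbabilityTheory.Indep (pointSigma L) (pointSigma E) μ)
    -- a unit-density Poisson process, for the typical Voronoi cell
    (T : Ω' → Set Plane) (hT : IsPoissonProcess ν T 1)
    -- transmit power, common noise power, and path-loss gain
    (P noise : ℝ) (hP : 0 < P) (hnoise : 0 < noise)
    (g : ℝ → ℝ → ℝ)
    (hg_cont : ContinuousOn (fun r => g r 1) (Set.Ioi 0))
    (hg_anti : StrictAntiOn (fun r => g r 1) (Set.Ioi 0))
    (hg_lim : Tendsto (fun r => g r 1) atTop (𝓝 0))
    -- the window used to select a typical node
    (W : Set Plane) (hW : MeasurableSet W) (hW_pos : volume W ≠ 0) (hW_fin : volume W ≠ ∞) :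
    -- the moment generating function, as a function with values in `[0, ∞]`
    (∀ s : ℝ,
      palmMean μ L lamL W (fun ω x => EReal.exp ((s : EReal) *
          ((inDegree (iSGraph P g (fun _ _ => 1) noise noise 0 (L ω) (E ω)) x : ℝ≥0∞) : EReal)))
        = ∫⁻ ω, EReal.exp ((((lamL / lamE : ℝ≥0) * (Real.exp s - 1) : ℝ) : EReal) *
            (originCellArea (T ω) : EReal)) ∂ν) ∧
    -- the moments
    (∀ n : ℕ, 1 ≤ n →
      palmMean μ L lamL W (fun ω x =>
          (inDegree (iSGraph P g (fun _ _ => 1) noise noise 0 (L ω) (E ω)) x : ℝ≥0∞) ^ n)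
        = ∑ k ∈ Finset.Icc 1 n, ((lamL / lamE : ℝ≥0) : ℝ≥0∞) ^ k * (Nat.stirlingSecond n k : ℝ≥0∞)
            * ∫⁻ ω, originCellArea (T ω) ^ k ∂ν) ∧
    -- these moments are finite
    (∀ k : ℕ, ∫⁻ ω, originCellArea (T ω) ^ k ∂ν ≠ ∞) := by
  have hpalm := palmMean_inDegree hlamL hlamE hL hE hLE hT hP hnoise hg_anti hg_lim hW hW_pos hW_fin
  have hmean (a : ℝ≥0) :
      lamL * ((lamE : ℝ≥0∞)⁻¹ * (a : ℝ≥0∞)).toNNReal = lamL / lamE * a := by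
    rw [← ENNReal.coe_inv hlamE.ne', ← ENNReal.coe_mul, ENNReal.toNNReal_coe, div_eq_mul_inv,
      mul_assoc]
  refine ⟨fun s => ?_, fun n hn => ?_, hT.lintegral_originCellArea_pow_ne_top one_pos⟩
  · refine (hpalm fun n => EReal.exp ((s : EReal) * ((n : ℝ≥0∞) : EReal))).trans ?_
    refine lintegral_congr_ae ?_
    -- Where the area is finite, it is a real parameter of the Poisson law and the identity holds
    -- pointwise.
    filter_upwards [hT.ae_originCellArea_lt_top] with ω hω
    lift originCellArea (T ω) to ℝ≥0 using hω.ne with a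
    rw [hmean, lintegral_exp_poissonENat, EReal.coe_nnreal_eq_coe_real, ← EReal.coe_mul,
      EReal.exp_coe]
    congr 2
    push_cast
    ring
  · refine (hpalm fun k => (k : ℝ≥0∞) ^ n).trans ?_
    simp_rw [← lintegral_const_mul _ (hT.measurable_originCellArea.pow_const _)]
    rw [← lintegral_finsetSum _ fun k _ => (hT.measurable_originCellArea.pow_const k).const_mul _]
    refine lintegral_congr_ae ?_
    filter_upwards [hT.ae_originCellArea_lt_top] with ω hω
    lift originCellArea (T ω) to ℝ≥0 using hω.ne with a
    rw [hmean, lintegral_pow_poissonENat _ hn]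
    refine Finset.sum_congr rfl fun k _ => ?_
    rw [ENNReal.coe_mul, mul_pow]
    ring
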